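/- **Notation.** For integers $k\ge 1$, $n\ge 0$ let $H_n^{(k)}=\sum_{j=1}^n j^{-k}$ and $H_n=H_n^{(1)}$. For a string $(s_1,\dots,s_q)$ of positive integers with $s_1\ge 2$ let $\zeta(s_1,\dots,s_q)=\lim_{n\to\infty}\sum_{n\ge n_1>\cdots>n_q\ge1} n_1^{-s_1}\cdots n_q^{-s_q}$ be the multiple zeta value, $\{1\}^a$ denoting $a$ repeated arguments $1$. Let $\left[{n\atop k}\right]$ be the unsigned Stirling numbers of the first kind. For $k\ge1$, $r\ge0$, $m\ge2$ put $$W_{k,r}(m)=(k-1)!\sum_{n=1}^\infty\frac{\left[{n+r+1\atop k}\right]}{(n+r)!\,n^m},$$ and for $k,m\ge 1$, $p\ge m+1$ put $$S(k,m;p)=\sum_{n=1}^\infty \frac{h_n^{(m)}(k)}{n^p},\qquad h_n^{(m)}(k)=\sum_{1\le n_{m+k-1}<\cdots<n_m\le n_{m-1}\le\cdots\le n_1\le n}\frac1{n_mn_{m+1}\cdots n_{m+k-1}}.$$ **Theorem.** All the series $W_{k,r}(m)$ ($k\ge1$, $r\ge0$, $m\ge2$), all the limits $\zeta(m,\{1\}^{k})$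 ($m\ge2$, $k\ge0$), and the series $S(2,r;p)$, $S(3,r;p)$ ($p\ge r+1\ge2$) converge, and the following hold. (1) For $k\ge2$, $m\ge2$: $\;W_{k,0}(m)=(k-1)!\left(\zeta(m+1,\{1\}^{k-2})+\zeta(m,\{1\}^{k-1})\right)$. (2) (Aomoto–Drinfeld–Zagier) For complex $x,y$ with $|x|<1$, $|y|<1$, $|x+y|<1$ (both series converging absolutely) $$\sum_{n,m=1}^\infty\zeta(m+1,\{1\}^{n-1})x^my^n=1-\exp\left(\sum_{n=2}^\infty\zeta(n)\frac{x^n+y^n-(x+y)^n}{n}\right).$$ Every $\zeta(m,\{1\}^{k})$ with $m\ge2$, $k\ge0$, and every $W_{k,0}(m)$ with $k\ge1$, $m\ge2$, is a polynomial with rational coefficients in the zeta values $\zeta(2),\zeta(3),\zeta(4),\dots$. (3) For $r\ge0$ and $m\ge2$: $$W_{2,r}(m)=W_{2,0}(m)+\sum_{l=1}^{m-1}(-1)^{l-1}\zeta(m+1-l)H_r^{(l)}+(-1)^{m-1}\sum_{j=1}^r\frac{H_j}{j^m},$$ $$\begin{aligned}W_{3,r}(m)={}&W_{3,0}(m)+2\sum_{i=1}^{m-1}(-1)^{i-1}H_r^{(i)}W_{2,0}(m+1-i)\\&+2\sum_{l=1}^{m-1}(-1)^{l-1}\zeta(m+1-l)\sum_{1\le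 i<j\le r}\frac1{i^l(j-i)}-2\sum_{l=1}^{m-1}(-1)^{l-1}\zeta(m+1-l)\sum_{1\le i<j\le r}\frac1{j^l(j-i)}\\&+(-1)^{m-1}\Big\{\sum_{j=1}^r\frac{H_j^2+H_j^{(2)}}{j^m}+2\zeta(2)H_r^{(m)}-2\sum_{j=1}^r\frac{H_j}{j^{m+1}}+2\sum_{1\le i<j\le r}\frac{H_i}{i^m(j-i)}-2\sum_{1\le i<j\le r}\frac{H_j}{j^m(j-i)}\Big\},\end{aligned}$$ $$\begin{aligned}W_{4,r}(m)={}&W_{4,0}(m)+3\sum_{l=1}^{m-1}(-1)^{l-1}H_r^{(l)}W_{3,0}(m+1-l)\\&+6\sum_{l=1}^{m-1}(-1)^{l-1}W_{2,0}(m+1-l)\sum_{1\le i<j\le r}\frac1{j-i}\Big(\frac1{i^l}-\frac1{j^l}\Big)\\&+(-1)^{m-1}\Big\{6\zeta(3)H_r^{(m)}-3\sum_{j=1}^r\frac{H_j^2+H_j^{(2)}}{j^{m+1}}+\sum_{j=1}^r\frac{H_j^3+3H_jH_j^{(2)}+2H_j^{(3)}}{j^m}\Big\}\\&+6(-1)^{m-1}\sum_{1\le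 i<j\le r}\frac1{j-i}\Big\{\frac1{i^m}\Big(\frac{H_i^2+H_i^{(2)}}2+\zeta(2)-\frac{H_i}i\Big)-\frac1{j^m}\Big(\frac{H_j^2+H_j^{(2)}}2+\zeta(2)-\frac{H_j}j\Big)\Big\}\\&+6\sum_{l=1}^{m-1}(-1)^{l-1}\zeta(m+1-l)\sum_{1\le i<j<k\le r}\Big\{\frac1{i^l(j-i)(k-i)}+\frac1{j^l(i-j)(k-j)}+\frac1{k^l(j-k)(i-k)}\Big\}\\&+6(-1)^{m-1}\sum_{1\le i<j<k\le r}\Big\{\frac{H_i}{i^m(j-i)(k-i)}+\frac{H_j}{j^m(i-j)(k-j)}+\frac{H_k}{k^m(j-k)(i-k)}\Big\}.\end{aligned}$$ (4) For $r\ge1$ and $p\ge r+1$: $$S(2,r;p)=\frac1{2!(r-1)!}\sum_{k=1}^r\left[{r\atop k}\right]\Big\{W_{3,r-1}(p+1-k)-2H_{r-1}W_{2,r-1}(p+1-k)+\big(H_{r-1}^2+H_{r-1}^{(2)}\big)\zeta(p+1-k)\Big\},$$ $$\begin{aligned}S(3,r;p)=\frac1{3!(r-1)!}\sum_{k=1}^r\left[{r\atop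 k}\right]\Big\{&W_{4,r-1}(p+1-k)-3H_{r-1}W_{3,r-1}(p+1-k)+3\big(H_{r-1}^2+H_{r-1}^{(2)}\big)W_{2,r-1}(p+1-k)\\&-\big(H_{r-1}^3+3H_{r-1}H_{r-1}^{(2)}+2H_{r-1}^{(3)}\big)\zeta(p+1-k)\Big\}.\end{aligned}$$ Consequently $S(2,r;p)$ and $S(3,r;p)$ are rational linear combinations of products of zeta values and harmonic numbers; as harmonic numbers are rational, this says that both lie in $\mathbb{Q}[\zeta(2),\zeta(3),\zeta(4),\dots]$. -/

import Mathlib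

namespace EulerSums

open Finset

/-- The generalized harmonic number `H_n^{(k)} = ∑_{j=1}^n 1 / j^k`. -/
noncomputable def H (k n : ℕ) : ℝ := ∑ j ∈ Icc 1 n, 1 / (j : ℝ) ^ k

/-- The multiple harmonic number
`H_n^{(s₁,…,s_r)} = ∑_{n ≥ n₁ > n₂ > ⋯ > n_r ≥ 1} 1 / (n₁^{s₁} ⋯ n_r^{s_r})`,
computed by summing over the largest index `n₁ = j` first; it is `1` for the empty string. -/
noncomputable def multiHarmonic : List ℕ → ℕ → ℝ
  | [], _ => 1
  | s :: t, n => ∑ j ∈ Icc 1 n, 1 / (j : ℝ) ^ s * multiHarmonic t (j - 1)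

/-- The multiple zeta value `ζ(s₁,…,s_r) = lim_{n → ∞} H_n^{(s₁,…,s_r)}`. -/
noncomputable def multiZeta (s : List ℕ) : ℝ :=
  Filter.limUnder Filter.atTop (fun n : ℕ => multiHarmonic s n)

/-- The value `ζ(s)` of the Riemann zeta function at a natural number, as a real number. -/
noncomputable def zetaValue (s : ℕ) : ℝ := (riemannZeta (s : ℂ)).re

theorem zetaValue_eq_tsum {s : ℕ} (hs : 2 ≤ s) :
    zetaValue s = ∑' n : ℕ, 1 / (n : ℝ) ^ s := by
  have h : riemannZeta (s : ℂ) = ((∑' n : ℕ, 1 / (n : ℝ) ^ s : ℝ) : ℂ) := by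
    rw [zeta_nat_eq_tsum_of_gt_one (by omega)]
    push_cast
    rfl
  rw [zetaValue, h, Complex.ofReal_re]

/-- The algebra `ℚ[ζ(2), ζ(3), ζ(4), …]` of all polynomials in zeta values with rational
coefficients, that is, of all rational linear combinations of products of zeta values. -/
noncomputable def zetaAlgebra : Subalgebra ℚ ℝ :=
  Algebra.adjoin ℚ {x : ℝ | ∃ s : ℕ, 2 ≤ s ∧ x = zetaValue s}

/-- The generalized hyperharmonic number `h_n^{(m)}(k)` for `m ≥ 1`, that is, the sum of
`1 / (n_m n_{m+1} ⋯ n_{m+k-1})` over all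
`1 ≤ n_{m+k-1} < ⋯ < n_m ≤ n_{m-1} ≤ ⋯ ≤ n_1 ≤ n`, computed by summing over `n_1 = j` first.
(The value for `m = 0` is a dummy.) -/
noncomputable def hyperharmonic : ℕ → ℕ → ℕ → ℝ
  | 0, _, _ => 0
  | 1, k, n => multiHarmonic (List.replicate k 1) n
  | m + 2, k, n => ∑ j ∈ Icc 1 n, hyperharmonic (m + 1) k j

/-- The `n`-th term, `n ≥ 1`, of the series `S(k, m; p)`. -/
noncomputable def STerm (k m p n : ℕ) : ℝ := hyperharmonic m k n / (n : ℝ) ^ p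

/-- `S(k, m; p) = ∑_{n ≥ 1} h_n^{(m)}(k) / n^p`. -/
noncomputable def S (k m p : ℕ) : ℝ := ∑' n : ℕ, STerm k m p (n + 1)

/-- The `n`-th term, `n ≥ 1`, of the series in `W_{k,r}(m)`. -/
noncomputable def WTerm (k r m n : ℕ) : ℝ :=
  (Nat.stirlingFirst (n + r + 1) k : ℝ) / ((Nat.factorial (n + r) : ℝ) * (n : ℝ) ^ m)

/-- `W_{k,r}(m) = (k - 1)! ∑_{n ≥ 1} [n + r + 1, k] / ((n + r)! n^m)`, where `[n, k]` are the
unsigned Stirling numbers of the first kind. -/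
noncomputable def W (k r m : ℕ) : ℝ :=
  (Nat.factorial (k - 1) : ℝ) * ∑' n : ℕ, WTerm k r m (n + 1)

/-- `∑_{1 ≤ i < j ≤ r} f i j`. -/
noncomputable def sumPairs (r : ℕ) (f : ℕ → ℕ → ℝ) : ℝ :=
  ∑ j ∈ Icc 1 r, ∑ i ∈ Ico 1 j, f i j

/-- `∑_{1 ≤ i < j < k ≤ r} f i j k`. -/
noncomputable def sumTriples (r : ℕ) (f : ℕ → ℕ → ℕ → ℝ) : ℝ :=
  ∑ k ∈ Icc 1 r, ∑ j ∈ Ico 1 k, ∑ i ∈ Ico 1 j, f i j k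

end EulerSums

namespace EulerSums

open Finset Filter Topology

/-! Write e_k(n) and h_k(n) for the elementary and complete symmetric polynomials of 1, 1/2, …, 1/n.
Since [n+1, k+1] / n! = e_k(n), every W_{k+1,r}(m) is k! ∑ e_k(n+r) / n^m. The generating product ∏
(1 + y/j) shows that e_k(n) grows slower than any power of n, which gives all convergence; the
Pascal rule for e_k gives the formula for W_{k,0}.

For the double generating function, sum first with the largest index fixed (`hasSum_double_fiber`).
What remains is, up to sign, the Gauss series ₂F₁(-x, y; 1-x; 1) without its first term. Gauss's
evaluation follows by iterating a contiguous relation c → c+1 (`gaussTerm_contiguous`) and letting c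
→ ∞; the logarithm of the resulting infinite product is the zeta series. On the lines x = zu, y = z
the relation g' = f' g for g = exp f becomes a recurrence between polynomials in u
(`genPoly_recurrence`), so induction on the weight puts all ζ(m, {1}^k) into the zeta algebra.

For W_{k,r}, expand e_k(n+r) over the blocks {1, …, n} and {n+1, …, n+r}. By partial fractions the
symmetric polynomials of the second block are sums of divided differences of i ↦ 1/(n+i), which are
linear in that function. This leaves ∑ e_k(n) / (n^m (n+i)) (`hasSum_shiftZeta`), reduced by
recursion on m to a sum that Abel summation evaluates through h_{k+1}(i)
(`hasSum_elemHarmonic_mul_sub`).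

For S(k, a+1; p), the hyperharmonic number is C(n+a, n) times e_k(1/(a+1), …, 1/(a+n))
(`hyperharmonic_succ_eq`). The binomial is a polynomial in n with Stirling coefficients, and the
symmetric polynomial is a combination of e_j(n+a) with coefficients ± h_s(a); this produces the W's.
-/

theorem sum_Icc_one_eq_sum_range {M : Type*} [AddCommMonoid M] (f : ℕ → M) (n : ℕ) :
    ∑ j ∈ Icc 1 n, f j = ∑ j ∈ range n, f (j + 1) := by
  induction n with
  | zero => simp
  | succ n ih => rw [Finset.sum_Icc_succ_top (by omega), ih, sum_range_succ]

/-! ### Elementary symmetric harmonic sums: generating product, growth, convergence. -/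

/-- The elementary symmetric polynomial `e_k(1, 1/2, …, 1/n)`. -/
noncomputable def elemHarmonic (k n : ℕ) : ℝ := multiHarmonic (List.replicate k 1) n

@[simp] theorem elemHarmonic_zero (n : ℕ) : elemHarmonic 0 n = 1 := by
  simp [elemHarmonic, multiHarmonic]

@[simp] theorem elemHarmonic_succ_zero (k : ℕ) : elemHarmonic (k + 1) 0 = 0 := by
  simp [elemHarmonic, multiHarmonic, List.replicate_succ]

theorem elemHarmonic_succ_succ (k n : ℕ) :
    elemHarmonic (k + 1) (n + 1) = elemHarmonic (k + 1) n + elemHarmonic k n / ((n : ℝ) + 1) := by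
  simp only [elemHarmonic, List.replicate_succ, multiHarmonic]
  rw [Finset.sum_Icc_succ_top (by omega)]
  simp only [pow_one, Nat.add_sub_cancel, Nat.cast_add, Nat.cast_one]
  ring

theorem elemHarmonic_nonneg (k n : ℕ) : 0 ≤ elemHarmonic k n := by
  induction n generalizing k with
  | zero => cases k <;> simp
  | succ n ih =>
    cases k with
    | zero => simp
    | succ k =>
      rw [elemHarmonic_succ_succ]
      have h1 := ih (k + 1)
      have h2 := ih k
      positivity

/-- Divided by the factorial, the Stirling recurrence becomes the Pascal rule for e_k. -/
theorem stirlingFirst_div_factorial (k n : ℕ) :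
    (Nat.stirlingFirst (n + 1) (k + 1) : ℝ) / (Nat.factorial n : ℝ) = elemHarmonic k n := by
  induction n generalizing k with
  | zero =>
    cases k with
    | zero => simp [Nat.stirlingFirst_self 1]
    | succ k => simp [Nat.stirlingFirst_eq_zero_of_lt (show 0 + 1 < k + 1 + 1 by omega)]
  | succ n ih =>
    have hn : (Nat.factorial n : ℝ) ≠ 0 := by positivity
    cases k with
    | zero =>
      rw [Nat.stirlingFirst_one_right]
      simp [Nat.factorial_ne_zero]
    | succ k =>
      rw [elemHarmonic_succ_succ, ← ih, ← ih, Nat.stirlingFirst_succ_succ, Nat.factorial_succ]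
      push_cast
      have : (n : ℝ) + 1 ≠ 0 := by positivity
      field_simp

/-- The sum is in fact finite. It is taken over all k so that it multiplies with infinite series,
and over ℝ and ℂ at once because the real case supplies the majorants for the complex one. -/
theorem hasSum_elemHarmonic_mul_pow {𝕜 : Type*} [RCLike 𝕜] (y : 𝕜) (n : ℕ) :
    HasSum (fun k => (elemHarmonic k n : 𝕜) * y ^ k) (∏ j ∈ range n, (1 + y / ((j : 𝕜) + 1))) := by
  induction n with
  | zero =>
    have h := hasSum_single (f := fun k => (elemHarmonic k 0 : 𝕜) * y ^ k) 0 (by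
      intro k hk
      obtain ⟨k, rfl⟩ := Nat.exists_eq_succ_of_ne_zero hk
      simp)
    simpa using h
  | succ n ih =>
    rw [prod_range_succ, mul_add, mul_one]
    have h0 := (hasSum_nat_add_iff (f := fun k => (elemHarmonic k n : 𝕜) * y ^ k) 1
      (g := (∏ j ∈ range n, (1 + y / ((j : 𝕜) + 1))) - 1)).2 (by simpa using ih)
    have h1 := ih.mul_right (y / ((n : 𝕜) + 1))
    rw [show (∏ j ∈ range n, (1 + y / ((j : 𝕜) + 1)))
      + (∏ j ∈ range n, (1 + y / ((j : 𝕜) + 1))) * (y / ((n : 𝕜) + 1))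
      = (∏ j ∈ range n, (1 + y / ((j : 𝕜) + 1))) - 1
      + (∏ j ∈ range n, (1 + y / ((j : 𝕜) + 1))) * (y / ((n : 𝕜) + 1)) + 1 by ring]
    have h2 := (hasSum_nat_add_iff (f := fun k => (elemHarmonic k (n + 1) : 𝕜) * y ^ k) 1
      (g := (∏ j ∈ range n, (1 + y / ((j : 𝕜) + 1))) - 1
      + (∏ j ∈ range n, (1 + y / ((j : 𝕜) + 1))) * (y / ((n : 𝕜) + 1)))).1 (by
        refine (h0.add h1).congr_fun ?_
        intro k
        simp only [elemHarmonic_succ_succ]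
        push_cast
        ring)
    simpa using h2

/-- From 1 + t ≤ exp t the product is at most exp(a H_n), and H_n ≤ 1 + log(n+1). -/
theorem prod_one_add_div_le {a : ℝ} (ha : 0 ≤ a) (n : ℕ) :
    ∏ j ∈ range n, (1 + a / ((j : ℝ) + 1)) ≤ Real.exp a * ((n : ℝ) + 1) ^ a := by
  have h1 : ∏ j ∈ range n, (1 + a / ((j : ℝ) + 1)) ≤ Real.exp (a * (harmonic n : ℝ)) := by
    rw [harmonic]
    push_cast
    rw [mul_sum, Real.exp_sum]
    refine prod_le_prod (fun j _ => by positivity) fun j _ => ?_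
    have := Real.add_one_le_exp (a * ((j : ℝ) + 1)⁻¹)
    rw [div_eq_mul_inv]
    linarith
  refine h1.trans ?_
  rw [Real.rpow_def_of_pos (by positivity), ← Real.exp_add]
  refine Real.exp_le_exp.2 ?_
  have h2 := harmonic_le_one_add_log n
  have h3 : Real.log n ≤ Real.log ((n : ℝ) + 1) := by
    rcases Nat.eq_zero_or_pos n with rfl | hn
    · simp
    · exact Real.log_le_log (by exact_mod_cast hn) (by linarith)
  nlinarith

/-- A single term of the generating series at y = a is at most the whole product, all terms being
nonnegative. -/
theorem elemHarmonic_le {a : ℝ} (ha : 0 < a) (k n : ℕ) :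
    elemHarmonic k n ≤ Real.exp a / a ^ k * ((n : ℝ) + 1) ^ a := by
  have h := le_hasSum (hasSum_elemHarmonic_mul_pow a n) k
    fun j _ => by have := elemHarmonic_nonneg j n; simp only [RCLike.ofReal_real_eq_id, id]; positivity
  have h2 := h.trans (prod_one_add_div_le ha.le n)
  simp only [RCLike.ofReal_real_eq_id, id] at h2
  rw [div_mul_eq_mul_div, le_div_iff₀ (by positivity)]
  exact h2

theorem summable_add_one_rpow {p : ℝ} (hp : p < -1) :
    Summable (fun n : ℕ => ((n : ℝ) + 1) ^ p) := by
  have := (summable_nat_add_iff 1).2 (Real.summable_nat_rpow.2 hp)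
  simpa using this

theorem summable_elemHarmonic_shift (k r m : ℕ) (hm : 2 ≤ m) :
    Summable (fun n : ℕ => elemHarmonic k (n + r) / ((n : ℝ) + 1) ^ m) := by
  -- The growth bound is used with a = 1/2; against an exponent m ≥ 2 this leaves 1/2 - 2 = -3/2 <
  -- -1.
  have h := (summable_add_one_rpow (p := -(3 / 2)) (by norm_num)).mul_left
    (Real.exp (1 / 2) / (1 / 2) ^ k * ((r : ℝ) + 1) ^ (1 / 2 : ℝ))
  refine Summable.of_nonneg_of_le (fun n => ?_) (fun n => ?_) h
  · have := elemHarmonic_nonneg k (n + r); positivity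
  · have hn : (0 : ℝ) < (n : ℝ) + 1 := by positivity
    have h1 := elemHarmonic_le (a := 1 / 2) (by norm_num) k (n + r)
    have h2 : (((n + r : ℕ) : ℝ) + 1) ^ (1 / 2 : ℝ)
        ≤ ((r : ℝ) + 1) ^ (1 / 2 : ℝ) * ((n : ℝ) + 1) ^ (1 / 2 : ℝ) := by
      rw [← Real.mul_rpow (by positivity) (by positivity)]
      refine Real.rpow_le_rpow (by positivity) ?_ (by norm_num)
      push_cast
      nlinarith [mul_nonneg (Nat.cast_nonneg (α := ℝ) n) (Nat.cast_nonneg (α := ℝ) r)]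
    have h3 : ((n : ℝ) + 1) ^ (2 : ℝ) ≤ ((n : ℝ) + 1) ^ m := by
      rw [← Real.rpow_natCast]
      exact Real.rpow_le_rpow_of_exponent_le (by linarith [Nat.cast_nonneg (α := ℝ) n])
        (by exact_mod_cast hm)
    have h4 : ((n : ℝ) + 1) ^ (-(3 / 2) : ℝ) * ((n : ℝ) + 1) ^ (2 : ℝ)
        = ((n : ℝ) + 1) ^ (1 / 2 : ℝ) := by
      rw [← Real.rpow_add hn]; norm_num
    rw [div_le_iff₀ (by positivity)]
    calc elemHarmonic k (n + r)
        ≤ Real.exp (1 / 2) / (1 / 2) ^ k * (((r : ℝ) + 1) ^ (1 / 2 : ℝ)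
            * ((n : ℝ) + 1) ^ (1 / 2 : ℝ)) := h1.trans (by gcongr)
      _ = Real.exp (1 / 2) / (1 / 2) ^ k * ((r : ℝ) + 1) ^ (1 / 2 : ℝ) *
            ((n : ℝ) + 1) ^ (-(3 / 2) : ℝ) * ((n : ℝ) + 1) ^ (2 : ℝ) := by
          rw [← h4]; ring
      _ ≤ _ := by gcongr

/-- This is the boundary term in the Abel summations below. -/
theorem tendsto_elemHarmonic_div (k i : ℕ) :
    Tendsto (fun n : ℕ => elemHarmonic k n * (1 / ((n : ℝ) + 1 + i))) atTop (𝓝 0) := by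
  have h := ((tendsto_rpow_neg_atTop (y := 1 / 2) (by norm_num)).comp
    (tendsto_atTop_add_const_right atTop (1 : ℝ) tendsto_natCast_atTop_atTop)).const_mul
    (Real.exp (1 / 2) / (1 / 2) ^ k)
  rw [mul_zero] at h
  refine squeeze_zero (fun n => ?_) (fun n => ?_) h
  · have := elemHarmonic_nonneg k n; positivity
  · have hn : (0 : ℝ) < (n : ℝ) + 1 := by positivity
    simp only [Function.comp]
    rw [mul_one_div, div_le_iff₀ (by positivity)]
    have h4 : ((n : ℝ) + 1) ^ (-(1 / 2) : ℝ) * ((n : ℝ) + 1)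
        = ((n : ℝ) + 1) ^ (1 / 2 : ℝ) := by
      nth_rewrite 2 [← Real.rpow_one ((n : ℝ) + 1)]
      rw [← Real.rpow_add hn]; norm_num
    calc elemHarmonic k n ≤ _ := elemHarmonic_le (a := 1 / 2) (by norm_num) k n
      _ = Real.exp (1 / 2) / (1 / 2) ^ k * ((n : ℝ) + 1) ^ (-(1 / 2) : ℝ) * ((n : ℝ) + 1) := by
          rw [← h4]; ring
      _ ≤ _ := by
          refine mul_le_mul_of_nonneg_left ?_ (by positivity)
          linarith [Nat.cast_nonneg (α := ℝ) i]

/-- The multiple zeta value `ζ(m, {1}^k)` as a single series. -/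
theorem hasSum_multiZeta (k m : ℕ) (hm : 2 ≤ m) :
    HasSum (fun n : ℕ => elemHarmonic k n / ((n : ℝ) + 1) ^ m)
      (multiZeta (m :: List.replicate k 1)) ∧
    Tendsto (fun n : ℕ => multiHarmonic (m :: List.replicate k 1) n) atTop
      (𝓝 (multiZeta (m :: List.replicate k 1))) := by
  have h := (summable_elemHarmonic_shift k 0 m hm).hasSum
  simp only [add_zero] at h
  have h2 : Tendsto (fun n : ℕ => multiHarmonic (m :: List.replicate k 1) n) atTop
      (𝓝 (∑' n : ℕ, elemHarmonic k n / ((n : ℝ) + 1) ^ m)) := by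
    refine h.tendsto_sum_nat.congr fun n => ?_
    simp only [multiHarmonic]
    rw [sum_Icc_one_eq_sum_range]
    refine sum_congr rfl fun j _ => ?_
    rw [Nat.add_sub_cancel, elemHarmonic]
    push_cast
    ring
  have h3 : multiZeta (m :: List.replicate k 1)
      = ∑' n : ℕ, elemHarmonic k n / ((n : ℝ) + 1) ^ m := h2.limUnder_eq
  rw [h3]
  exact ⟨h, h2⟩

/-! ### Complete symmetric harmonic sums and Abel summation. -/

/-- The complete homogeneous symmetric polynomial `h_k(1, 1/2, …, 1/n)`. -/
noncomputable def completeHarmonic : ℕ → ℕ → ℝ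
  | 0, _ => 1
  | _ + 1, 0 => 0
  | k + 1, n + 1 => completeHarmonic (k + 1) n + completeHarmonic k (n + 1) / ((n : ℝ) + 1)

theorem H_succ (k n : ℕ) : H k (n + 1) = H k n + 1 / ((n : ℝ) + 1) ^ k := by
  rw [H, H, Finset.sum_Icc_succ_top (by omega)]
  push_cast
  rfl

@[simp] theorem H_zero (k : ℕ) : H k 0 = 0 := by simp [H]

theorem completeHarmonic_one (n : ℕ) : completeHarmonic 1 n = H 1 n := by
  induction n with
  | zero => simp [completeHarmonic]
  | succ n ih => rw [completeHarmonic, ih, H_succ, completeHarmonic, pow_one]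

theorem completeHarmonic_two (n : ℕ) : completeHarmonic 2 n = (H 1 n ^ 2 + H 2 n) / 2 := by
  induction n with
  | zero => simp [completeHarmonic]
  | succ n ih =>
    rw [completeHarmonic, ih, completeHarmonic_one, H_succ, H_succ]
    have : (n : ℝ) + 1 ≠ 0 := by positivity
    field_simp
    ring

theorem completeHarmonic_three (n : ℕ) :
    completeHarmonic 3 n = (H 1 n ^ 3 + 3 * H 1 n * H 2 n + 2 * H 3 n) / 6 := by
  induction n with
  | zero => simp [completeHarmonic]
  | succ n ih =>
    rw [completeHarmonic, ih, completeHarmonic_two, H_succ, H_succ, H_succ]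
    have : (n : ℝ) + 1 ≠ 0 := by positivity
    field_simp
    ring

/-- Summation by parts for series with nonnegative terms. -/
theorem hasSum_mul_sub_of_hasSum_sub_mul {e b : ℕ → ℝ} {s : ℝ} (he : ∀ n, 0 ≤ e n)
    (hb : ∀ n, b (n + 1) ≤ b n) (h0 : Tendsto (fun n => e n * b n) atTop (𝓝 0))
    (h : HasSum (fun n => (e (n + 1) - e n) * b (n + 1)) s) :
    HasSum (fun n => e n * (b n - b (n + 1))) (s + e 0 * b 0) := by
  rw [hasSum_iff_tendsto_nat_of_nonneg fun n => mul_nonneg (he n) (sub_nonneg.2 (hb n))]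
  have h1 := (h.tendsto_sum_nat.add_const (e 0 * b 0)).sub h0
  rw [sub_zero] at h1
  refine h1.congr fun N => ?_
  induction N with
  | zero => simp
  | succ N ih => rw [sum_range_succ, sum_range_succ, ← ih]; ring

theorem tendsto_one_div_add (i : ℕ) :
    Tendsto (fun n : ℕ => 1 / ((n : ℝ) + 1 + i)) atTop (𝓝 0) := by
  simpa using tendsto_elemHarmonic_div 0 i

theorem one_div_add_succ_le (i n : ℕ) :
    1 / (((n + 1 : ℕ) : ℝ) + 1 + i) ≤ 1 / ((n : ℝ) + 1 + i) := by
  apply one_div_le_one_div_of_le (by positivity)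
  push_cast
  linarith

/-- Telescoping in i reduces to the differences 1/(n+1+i) - 1/(n+2+i). Abel summation moves the
difference onto e_k, whose increment is e_{k-1}(n)/(n+1); partial fractions of 1/((n+1)(n+2+i)) then
give the same statement for k-1 at shift i+1, divided by i+1. This is the recursion defining h_k. -/
theorem hasSum_elemHarmonic_mul_sub (k i : ℕ) :
    HasSum (fun n : ℕ => elemHarmonic k n * (1 / ((n : ℝ) + 1) - 1 / ((n : ℝ) + 1 + i)))
      (completeHarmonic (k + 1) i) := by
  suffices hstep : ∀ i : ℕ, HasSum (fun n : ℕ => elemHarmonic k n *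
      (1 / ((n : ℝ) + 1 + i) - 1 / (((n + 1 : ℕ) : ℝ) + 1 + i)))
      (completeHarmonic k (i + 1) / ((i : ℝ) + 1)) by
    induction i with
    | zero => simp [completeHarmonic]
    | succ i ih =>
      rw [completeHarmonic]
      refine (ih.add (hstep i)).congr_fun fun n => ?_
      push_cast
      ring
  clear i
  induction k with
  | zero =>
    intro i
    -- A constant sequence has zero increments, so only the boundary term b 0 = 1/(1+i) survives.
    have h := hasSum_mul_sub_of_hasSum_sub_mul (e := fun _ => 1) (s := 0)
      (b := fun n : ℕ => 1 / ((n : ℝ) + 1 + i)) (fun _ => zero_le_one)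
      (one_div_add_succ_le i) (by simpa using tendsto_one_div_add i) (by simp)
    convert h using 1
    · simp
    · simp [completeHarmonic, add_comm]
  | succ k ih =>
    intro i
    have h := hasSum_mul_sub_of_hasSum_sub_mul (e := elemHarmonic (k + 1))
      (s := completeHarmonic (k + 1) (i + 1) / ((i : ℝ) + 1))
      (b := fun n : ℕ => 1 / ((n : ℝ) + 1 + i)) (elemHarmonic_nonneg _)
      (one_div_add_succ_le i) (tendsto_elemHarmonic_div _ i) ?_
    · simpa using h
    -- The induction hypothesis concerns consecutive differences; the full difference up to shift
    -- i+1 is reassembled from it by telescoping.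
    · have hk : HasSum (fun n : ℕ => elemHarmonic k n *
          (1 / ((n : ℝ) + 1) - 1 / ((n : ℝ) + 1 + (i + 1 : ℕ))))
          (completeHarmonic (k + 1) (i + 1)) := by
        generalize i + 1 = i
        induction i with
        | zero => simp [completeHarmonic]
        | succ i ih2 =>
          rw [completeHarmonic]
          refine (ih2.add (ih i)).congr_fun fun n => ?_
          push_cast
          ring
      refine (hk.div_const ((i : ℝ) + 1)).congr_fun fun n => ?_
      rw [elemHarmonic_succ_succ]
      have h1 : (n : ℝ) + 1 ≠ 0 := by positivity
      have h2 : (i : ℝ) + 1 ≠ 0 := by positivity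
      have h3 : (n : ℝ) + 1 + 1 + i ≠ 0 := by positivity
      have h4 : (n : ℝ) + 1 + (i + 1) ≠ 0 := by positivity
      push_cast
      field_simp
      ring

/-- The value of `∑ e_k(1, …, 1/n) (1/n - 1/(n+i))`. -/
noncomputable def shiftConst : ℕ → ℕ → ℝ
  | 0, i => completeHarmonic 1 i
  | k + 1, i => completeHarmonic (k + 2) i + multiZeta (2 :: List.replicate k 1)
      - completeHarmonic (k + 1) i / (i : ℝ)

/-- With N = n+1, split e_{k+1}(N) = e_{k+1}(n) + e_k(n)/N and use (1/N)(1/N - 1/(N+i)) = 1/N² -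
(1/N - 1/(N+i))/i. The first piece yields h_{k+2}(i), the others ζ(2, {1}^k) and -h_{k+1}(i)/i. -/
theorem hasSum_elemHarmonic_succ_mul_sub (k i : ℕ) (hi : i ≠ 0) :
    HasSum (fun n : ℕ => elemHarmonic k (n + 1) *
      (1 / ((n : ℝ) + 1) - 1 / ((n : ℝ) + 1 + i))) (shiftConst k i) := by
  cases k with
  | zero => simpa [shiftConst] using hasSum_elemHarmonic_mul_sub 0 i
  | succ k =>
    have h1 := hasSum_elemHarmonic_mul_sub (k + 1) i
    have h2 := (hasSum_multiZeta k 2 le_rfl).1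
    have h3 := (hasSum_elemHarmonic_mul_sub k i).div_const (i : ℝ)
    rw [shiftConst]
    refine ((h1.add h2).sub h3).congr_fun fun n => ?_
    rw [elemHarmonic_succ_succ]
    have h1 : (n : ℝ) + 1 ≠ 0 := by positivity
    have h2 : (i : ℝ) ≠ 0 := by positivity
    have h3 : (n : ℝ) + 1 + i ≠ 0 := by positivity
    field_simp
    ring

/-! ### The double generating series summed over the largest index. -/

theorem norm_natCast_add_one {𝕜 : Type*} [RCLike 𝕜] (n : ℕ) : ‖((n : 𝕜) + 1)‖ = (n : ℝ) + 1 := by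
  have := RCLike.norm_natCast (K := 𝕜) (n + 1)
  push_cast at this
  exact this

theorem natCast_add_one_ne_zero {𝕜 : Type*} [RCLike 𝕜] (n : ℕ) : ((n : 𝕜) + 1) ≠ 0 := by
  exact_mod_cast n.succ_ne_zero

theorem natCast_add_one_sub_ne_zero {𝕜 : Type*} [RCLike 𝕜] {x : 𝕜} (hx : ‖x‖ < 1) (n : ℕ) :
    ((n : 𝕜) + 1 - x) ≠ 0 := by
  intro h
  have h1 := norm_natCast_add_one (𝕜 := 𝕜) n
  rw [sub_eq_zero.1 h] at h1
  linarith [Nat.cast_nonneg (α := ℝ) n]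

theorem norm_div_natCast_add_one_lt {𝕜 : Type*} [RCLike 𝕜] {x : 𝕜} (hx : ‖x‖ < 1) (n : ℕ) :
    ‖x / ((n : 𝕜) + 1)‖ < 1 := by
  rw [norm_div, norm_natCast_add_one]
  exact (div_le_self (norm_nonneg _) (by linarith [Nat.cast_nonneg (α := ℝ) n])).trans_lt hx

/-- For fixed n the double sum factors into a geometric series in x/(n+1) and the generating product
in y. -/
theorem hasSum_double_fiber {𝕜 : Type*} [RCLike 𝕜] {x : 𝕜} (hx : ‖x‖ < 1) (y : 𝕜) (n : ℕ) :
    HasSum (fun q : ℕ × ℕ => ((elemHarmonic q.2 n : ℝ) : 𝕜) / ((n : 𝕜) + 1) ^ (q.1 + 2)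
        * x ^ (q.1 + 1) * y ^ (q.2 + 1))
      (x * y / (((n : 𝕜) + 1) * ((n : 𝕜) + 1 - x)) * ∏ j ∈ range n, (1 + y / ((j : 𝕜) + 1))) := by
  have hn := natCast_add_one_ne_zero (𝕜 := 𝕜) n
  have hnx := natCast_add_one_sub_ne_zero hx n
  have hlt := norm_div_natCast_add_one_lt hx n
  have h1 := (hasSum_geometric_of_norm_lt_one hlt).mul_left (x / ((n : 𝕜) + 1) ^ 2)
  have h2 := (hasSum_elemHarmonic_mul_pow y n).mul_left y
  have s1 : Summable fun i : ℕ => ‖x / ((n : 𝕜) + 1) ^ 2 * (x / ((n : 𝕜) + 1)) ^ i‖ := by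
    simp_rw [norm_mul, norm_pow]
    exact (summable_geometric_of_lt_one (norm_nonneg _) hlt).mul_left _
  have s2 : Summable fun k : ℕ => ‖y * (((elemHarmonic k n : ℝ) : 𝕜) * y ^ k)‖ := by
    have := ((hasSum_elemHarmonic_mul_pow ‖y‖ n).mul_left ‖y‖).summable
    refine this.congr fun k => ?_
    simp only [norm_mul, norm_pow, RCLike.norm_ofReal, abs_of_nonneg (elemHarmonic_nonneg k n)]
    rfl
  have h3 := (summable_mul_of_summable_norm s1 s2).hasSum
  rw [← tsum_mul_tsum_of_summable_norm s1 s2, h1.tsum_eq, h2.tsum_eq] at h3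
  convert h3 using 1
  · funext q
    rw [div_pow]
    field_simp
    ring
  · rw [one_sub_div hn]
    field_simp

/-- The summand of the Gauss series obtained from the double series over the largest index. -/
theorem norm_gauss_term_le {𝕜 : Type*} [RCLike 𝕜] {x : 𝕜} (hx : ‖x‖ < 1) (y : 𝕜) (n : ℕ) :
    ‖x * y / (((n : 𝕜) + 1) * ((n : 𝕜) + 1 - x)) * ∏ j ∈ range n, (1 + y / ((j : 𝕜) + 1))‖
      ≤ ‖x‖ * ‖y‖ / (1 - ‖x‖) * Real.exp ‖y‖ * ((n : ℝ) + 1) ^ (‖y‖ - 2) := by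
  have hn : (0 : ℝ) < (n : ℝ) + 1 := by positivity
  have h1 : ((n : ℝ) + 1) * (1 - ‖x‖) ≤ ‖(n : 𝕜) + 1 - x‖ := by
    have := norm_sub_norm_le ((n : 𝕜) + 1) x
    rw [norm_natCast_add_one] at this
    nlinarith [norm_nonneg x, Nat.cast_nonneg (α := ℝ) n]
  have h2 : ‖∏ j ∈ range n, (1 + y / ((j : 𝕜) + 1))‖
      ≤ Real.exp ‖y‖ * ((n : ℝ) + 1) ^ ‖y‖ := by
    refine le_trans ?_ (prod_one_add_div_le (norm_nonneg y) n)
    rw [norm_prod]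
    refine prod_le_prod (fun _ _ => norm_nonneg _) fun j _ => ?_
    refine (norm_add_le _ _).trans ?_
    rw [norm_one, norm_div, norm_natCast_add_one]
  have h3 : ((n : ℝ) + 1) ^ (‖y‖ - 2) = ((n : ℝ) + 1) ^ ‖y‖ / ((n : ℝ) + 1) ^ 2 := by
    rw [Real.rpow_sub hn]
    norm_num
  have hx' : 0 < 1 - ‖x‖ := by linarith
  rw [norm_mul, norm_div, norm_mul, norm_mul, norm_natCast_add_one, h3]
  calc _ ≤ ‖x‖ * ‖y‖ / (((n : ℝ) + 1) * (((n : ℝ) + 1) * (1 - ‖x‖))) *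
        (Real.exp ‖y‖ * ((n : ℝ) + 1) ^ ‖y‖) := by gcongr
    _ = _ := by field_simp

theorem summable_norm_gauss_term {𝕜 : Type*} [RCLike 𝕜] {x y : 𝕜} (hx : ‖x‖ < 1) (hy : ‖y‖ < 1) :
    Summable fun n : ℕ => ‖x * y / (((n : 𝕜) + 1) * ((n : 𝕜) + 1 - x)) *
      ∏ j ∈ range n, (1 + y / ((j : 𝕜) + 1))‖ :=
  Summable.of_nonneg_of_le (fun _ => norm_nonneg _) (norm_gauss_term_le hx y)
    ((summable_add_one_rpow (by linarith)).mul_left _)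

theorem hasSum_multiZeta_double {x y : ℂ} (hx : ‖x‖ < 1) (hy : ‖y‖ < 1) :
    HasSum (fun q : ℕ × ℕ =>
        (multiZeta ((q.1 + 2) :: List.replicate q.2 1) : ℂ) * x ^ (q.1 + 1) * y ^ (q.2 + 1))
      (∑' n : ℕ, x * y / (((n : ℂ) + 1) * ((n : ℂ) + 1 - x)) *
        ∏ j ∈ range n, (1 + y / ((j : ℂ) + 1))) := by
  set f : ℕ × (ℕ × ℕ) → ℂ := fun p => ((elemHarmonic p.2.2 p.1 : ℝ) : ℂ) /
    ((p.1 : ℂ) + 1) ^ (p.2.1 + 2) * x ^ (p.2.1 + 1) * y ^ (p.2.2 + 1) with hf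
  have hnorm : ∀ p, ‖f p‖ = elemHarmonic p.2.2 p.1 /
      ((p.1 : ℝ) + 1) ^ (p.2.1 + 2) * ‖x‖ ^ (p.2.1 + 1) * ‖y‖ ^ (p.2.2 + 1) := by
    intro p
    simp only [hf, norm_mul, norm_div, norm_pow]
    rw [norm_natCast_add_one, Complex.norm_real, Real.norm_eq_abs,
      abs_of_nonneg (elemHarmonic_nonneg _ _)]
  -- Absolute convergence of the triple series is the same fiberwise evaluation at the real numbers
  -- ‖x‖ and ‖y‖.
  have hx' : ‖(‖x‖ : ℝ)‖ < 1 := by simpa using hx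
  have hy' : ‖(‖y‖ : ℝ)‖ < 1 := by simpa using hy
  have hs : Summable f := by
    apply Summable.of_norm
    rw [summable_prod_of_nonneg (fun _ => norm_nonneg _)]
    constructor
    · intro n
      simp_rw [hnorm]
      exact (hasSum_double_fiber hx' ‖y‖ n).summable
    · refine (summable_norm_gauss_term hx' hy').of_norm.congr fun n => ?_
      rw [tsum_congr fun b => hnorm (n, b)]
      exact (hasSum_double_fiber hx' ‖y‖ n).tsum_eq.symm
  have h1 := hs.hasSum
  have h2 : ∑' p, f p = ∑' n : ℕ, x * y / (((n : ℂ) + 1) * ((n : ℂ) + 1 - x)) *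
        ∏ j ∈ range n, (1 + y / ((j : ℂ) + 1)) :=
    ((h1.prod_fiberwise fun n => hasSum_double_fiber hx y n).tsum_eq).symm
  rw [← h2]
  refine ((Equiv.prodComm (ℕ × ℕ) ℕ).hasSum_iff.2 h1).prod_fiberwise fun q => ?_
  have h3 := (hasSum_multiZeta q.2 (q.1 + 2) (by omega)).1
  have h4 := ((Complex.hasSum_ofReal.2 h3).mul_right (x ^ (q.1 + 1))).mul_right (y ^ (q.2 + 1))
  refine h4.congr_fun fun n => ?_
  simp [hf]

/-! ### Gauss's summation theorem by a contiguous relation. -/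

/-- The terms of the Gauss series `₂F₁(-x, y; c; 1)`. -/
noncomputable def gaussTerm (x y c : ℂ) (n : ℕ) : ℂ :=
  ∏ j ∈ range n, ((j - x) * (j + y) / (((1 : ℂ) + j) * (c + j)))

/-- For c = 1 - x the factors (j-x)/(j+1-x) telescope to -x/(n+1-x). -/
theorem gaussTerm_succ_eq {x : ℂ} (hx : ‖x‖ < 1) (y : ℂ) (n : ℕ) :
    gaussTerm x y (1 - x) (n + 1) = -(x * y / (((n : ℂ) + 1) * ((n : ℂ) + 1 - x)) *
      ∏ j ∈ range n, (1 + y / ((j : ℂ) + 1))) := by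
  induction n with
  | zero =>
    have h0 := natCast_add_one_sub_ne_zero hx 0
    simp only [gaussTerm, prod_range_succ, prod_range_zero, Nat.cast_zero] at h0 ⊢
    rw [zero_add] at h0
    field_simp
    ring
  | succ n ih =>
    rw [gaussTerm, prod_range_succ, ← gaussTerm, ih, prod_range_succ]
    have h0 := natCast_add_one_sub_ne_zero hx n
    have h1 := natCast_add_one_sub_ne_zero hx (n + 1)
    have h2 := natCast_add_one_ne_zero (𝕜 := ℂ) n
    have h3 := natCast_add_one_ne_zero (𝕜 := ℂ) (n + 1)
    have h4 : (1 : ℂ) + ((n + 1 : ℕ) : ℂ) ≠ 0 := by rw [add_comm]; exact h3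
    have h5 : 1 - x + ((n + 1 : ℕ) : ℂ) ≠ 0 := by
      rw [show 1 - x + ((n + 1 : ℕ) : ℂ) = ((n + 1 : ℕ) : ℂ) + 1 - x by ring]; exact h1
    push_cast at h1 h3 h4 h5 ⊢
    field_simp
    ring

theorem norm_le_norm_add_natCast {z : ℂ} (hz : 0 ≤ z.re) (m : ℕ) : ‖z‖ ≤ ‖z + m‖ := by
  rw [Complex.norm_def, Complex.norm_def]
  apply Real.sqrt_le_sqrt
  simp only [Complex.normSq_apply, Complex.add_re, Complex.natCast_re, Complex.add_im,
    Complex.natCast_im, add_zero]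
  nlinarith [Nat.cast_nonneg (α := ℝ) m, mul_nonneg hz (Nat.cast_nonneg (α := ℝ) m)]

/-- As Re(1-x) > 0, increasing c by m only enlarges the denominators. This gives a majorant
independent of m for the limit c → ∞. -/
theorem norm_gaussTerm_le {x : ℂ} (hx : ‖x‖ < 1) (y : ℂ) (m n : ℕ) :
    ‖gaussTerm x y (1 - x + m) n‖ ≤ ‖gaussTerm x y (1 - x) n‖ := by
  simp only [gaussTerm, norm_prod]
  refine prod_le_prod (fun _ _ => norm_nonneg _) fun j _ => ?_
  rw [norm_div, norm_div, norm_mul, norm_mul, norm_mul]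
  have h1 := natCast_add_one_sub_ne_zero hx j
  rw [show (j : ℂ) + 1 - x = 1 - x + j by ring] at h1
  have h1' := norm_pos_iff.2 h1
  have h2 : ‖1 - x + j‖ ≤ ‖1 - x + m + j‖ := by
    rw [add_right_comm]
    apply norm_le_norm_add_natCast
    have := (Complex.abs_re_le_norm x).trans_lt hx
    simp only [Complex.add_re, Complex.sub_re, Complex.one_re, Complex.natCast_re]
    linarith [Nat.cast_nonneg (α := ℝ) j, le_abs_self x.re]
  have h3 : 0 < ‖(1 : ℂ) + j‖ := by
    rw [add_comm, norm_natCast_add_one]; positivity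
  gcongr

theorem summable_norm_gaussTerm {x y : ℂ} (hx : ‖x‖ < 1) (hy : ‖y‖ < 1) :
    Summable fun n => ‖gaussTerm x y (1 - x) n‖ := by
  rw [← summable_nat_add_iff 1]
  refine (summable_norm_gauss_term hx hy).congr fun n => ?_
  rw [gaussTerm_succ_eq hx, norm_neg]

theorem summable_gaussTerm {x y : ℂ} (hx : ‖x‖ < 1) (hy : ‖y‖ < 1) (m : ℕ) :
    Summable (gaussTerm x y (1 - x + m)) :=
  Summable.of_norm_bounded (summable_norm_gaussTerm hx hy) (norm_gaussTerm_le hx y m)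

theorem tendsto_mul_gaussTerm {x y : ℂ} (hx : ‖x‖ < 1) (hy : ‖y‖ < 1) (m : ℕ) :
    Tendsto (fun n : ℕ => (n : ℂ) * gaussTerm x y (1 - x + m) n) atTop (𝓝 0) := by
  rw [← tendsto_add_atTop_iff_nat 1]
  have h := ((tendsto_rpow_neg_atTop (y := 1 - ‖y‖) (by linarith)).comp
    (tendsto_atTop_add_const_right atTop (1 : ℝ) tendsto_natCast_atTop_atTop)).const_mul
    (‖x‖ * ‖y‖ / (1 - ‖x‖) * Real.exp ‖y‖)
  rw [mul_zero] at h
  refine squeeze_zero_norm (fun n => ?_) h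
  have hn : (0 : ℝ) < (n : ℝ) + 1 := by positivity
  have h1 := norm_gaussTerm_le hx y m (n + 1)
  rw [gaussTerm_succ_eq hx, norm_neg] at h1
  have h2 := h1.trans (norm_gauss_term_le hx y n)
  rw [norm_mul]
  push_cast
  rw [norm_natCast_add_one]
  simp only [Function.comp]
  have h4 : ((n : ℝ) + 1) * ((n : ℝ) + 1) ^ (‖y‖ - 2) = ((n : ℝ) + 1) ^ (-(1 - ‖y‖)) := by
    nth_rewrite 1 [← Real.rpow_one ((n : ℝ) + 1)]
    rw [← Real.rpow_add hn]
    congr 1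
    ring
  rw [← h4]
  calc _ ≤ _ := mul_le_mul_of_nonneg_left h2 hn.le
    _ = _ := by ring

/-- The right-hand side is a difference of consecutive values of n · `gaussTerm x y c n`, so
summation over n telescopes and leaves a linear relation between the series at c and at c+1. -/
theorem gaussTerm_contiguous {x y c : ℂ} (hc : ∀ j : ℕ, c + j ≠ 0) (n : ℕ) :
    c * (c + x - y) * gaussTerm x y c n - (c + x) * (c - y) * gaussTerm x y (c + 1) n
      = -c * (((n + 1 : ℕ) : ℂ) * gaussTerm x y c (n + 1) - n * gaussTerm x y c n) := by
  -- The quotients (c+j)/(c+1+j) of corresponding factors telescope to c/(c+n).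
  have h1 : gaussTerm x y (c + 1) n * (c + n) = gaussTerm x y c n * c := by
    induction n with
    | zero => simp [gaussTerm]
    | succ n ih =>
      rw [gaussTerm, gaussTerm, prod_range_succ, prod_range_succ, ← gaussTerm, ← gaussTerm]
      have h2 := hc n
      have h3 := hc (n + 1)
      have h4 : c + 1 + (n : ℂ) ≠ 0 := by
        rw [add_assoc, add_comm (1 : ℂ)]; exact_mod_cast h3
      have h5 : (1 : ℂ) + n ≠ 0 := by rw [add_comm]; exact natCast_add_one_ne_zero n
      rw [show gaussTerm x y (c + 1) n = gaussTerm x y c n * c / (c + n) by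
        rw [eq_div_iff h2, ih]]
      push_cast at h3 ⊢
      field_simp
      ring
  have h2 := hc n
  have h5 : (1 : ℂ) + n ≠ 0 := by rw [add_comm]; exact natCast_add_one_ne_zero n
  rw [show gaussTerm x y (c + 1) n = gaussTerm x y c n * c / (c + n) by
        rw [eq_div_iff h2, h1], gaussTerm.eq_1 x y c (n + 1), prod_range_succ, ← gaussTerm]
  push_cast
  field_simp
  ring

theorem tsum_gaussTerm_step {x y : ℂ} (hx : ‖x‖ < 1) (hy : ‖y‖ < 1) (m : ℕ) :
    ∑' n, gaussTerm x y (1 - x + m) n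
      = (((m : ℂ) + 1) * ((m : ℂ) + 1 - (x + y)) / (((m : ℂ) + 1 - x) * ((m : ℂ) + 1 - y)))
        * ∑' n, gaussTerm x y (1 - x + (m + 1 : ℕ)) n := by
  have hs1 := summable_gaussTerm hx hy m
  have hs2 := summable_gaussTerm hx hy (m + 1)
  set c : ℂ := 1 - x + m with hc
  have hc1 : (1 - x + (m + 1 : ℕ) : ℂ) = c + 1 := by rw [hc]; push_cast; ring
  rw [hc1] at hs2 ⊢
  have hne : ∀ j : ℕ, c + j ≠ 0 := by
    intro j
    have := natCast_add_one_sub_ne_zero hx (m + j)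
    rw [hc]
    push_cast at this
    rwa [show 1 - x + (m : ℂ) + j = (m : ℂ) + j + 1 - x by ring]
  have h1 := ((hs1.hasSum.mul_left (c * (c + x - y))).sub
    (hs2.hasSum.mul_left ((c + x) * (c - y)))).tendsto_sum_nat
  have h2 := (tendsto_mul_gaussTerm hx hy m).const_mul (-c)
  have h3 := tendsto_nhds_unique h1 (h2.congr fun N => by
    induction N with
    | zero => simp
    | succ N ih => rw [sum_range_succ, ← ih, gaussTerm_contiguous hne, ← hc]; ring)
  have e1 : c = (m : ℂ) + 1 - x := by rw [hc]; ring
  have n1 := natCast_add_one_sub_ne_zero hx m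
  have n2 := natCast_add_one_sub_ne_zero hy m
  rw [mul_zero, sub_eq_zero] at h3
  have h4 : ((m : ℂ) + 1 - x) * ((m : ℂ) + 1 - y) * ∑' n, gaussTerm x y c n
      = ((m : ℂ) + 1) * ((m : ℂ) + 1 - (x + y)) * ∑' n, gaussTerm x y (c + 1) n := by
    have : c + x - y = (m : ℂ) + 1 - y := by rw [hc]; ring
    rw [this] at h3
    have : (c + x) * (c - y) = ((m : ℂ) + 1) * ((m : ℂ) + 1 - (x + y)) := by rw [hc]; ring
    rw [this] at h3
    rw [← e1]
    linear_combination h3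
  field_simp
  linear_combination h4

theorem tendsto_tsum_gaussTerm {x y : ℂ} (hx : ‖x‖ < 1) (hy : ‖y‖ < 1) :
    Tendsto (fun m : ℕ => ∑' n, gaussTerm x y (1 - x + m) n) atTop (𝓝 1) := by
  have h := tendsto_tsum_of_dominated_convergence (𝓕 := atTop)
    (f := fun m : ℕ => gaussTerm x y (1 - x + m))
    -- The termwise limit: the empty product 1 at n = 0, and 0 for every n > 0.
    (g := fun n => ∏ _j ∈ range n, (0 : ℂ))
    (summable_norm_gaussTerm hx hy) (fun n => ?_)
    (Eventually.of_forall fun m n => norm_gaussTerm_le hx y m n)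
  · rwa [tsum_eq_single 0 (fun n hn => by simp [hn]), prod_range_zero] at h
  · refine tendsto_finsetProd _ fun j _ => ?_
    have h2 := (tendsto_inv_atTop_nhds_zero_nat (𝕜 := ℝ)).const_mul ‖(j - x) * (j + y) / (1 + j)‖
    rw [mul_zero] at h2
    refine squeeze_zero_norm' ?_ h2
    filter_upwards [eventually_gt_atTop 0] with m hm
    have hm' : (0 : ℝ) < m := by exact_mod_cast hm
    rw [← div_div, norm_div, div_eq_mul_inv]
    refine mul_le_mul_of_nonneg_left (inv_anti₀ hm' ?_) (norm_nonneg _)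
    refine le_trans ?_ (Complex.re_le_norm _)
    have := (Complex.abs_re_le_norm x).trans_lt hx
    simp only [Complex.add_re, Complex.sub_re, Complex.one_re, Complex.natCast_re]
    linarith [Nat.cast_nonneg (α := ℝ) j, le_abs_self x.re]

theorem tsum_gaussTerm_eq_prod_mul {x y : ℂ} (hx : ‖x‖ < 1) (hy : ‖y‖ < 1) (m : ℕ) :
    ∑' n, gaussTerm x y (1 - x) n = (∏ n ∈ range m,
      (((n : ℂ) + 1) * ((n : ℂ) + 1 - (x + y)) / (((n : ℂ) + 1 - x) * ((n : ℂ) + 1 - y))))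
      * ∑' n, gaussTerm x y (1 - x + m) n := by
  induction m with
  | zero => simp
  | succ m ih => rw [ih, prod_range_succ, tsum_gaussTerm_step hx hy, mul_assoc]

/-! ### The Gauss product as the exponential of a zeta series. -/

/-- The terms of the double series for the logarithm of the Gauss product. -/
noncomputable def logTerm (x y : ℂ) (k n : ℕ) : ℂ :=
  (x ^ (k + 2) + y ^ (k + 2) - (x + y) ^ (k + 2)) / ((k : ℂ) + 2) * (1 / ((n : ℂ) + 1) ^ (k + 2))

theorem exp_tsum_logTerm {x y : ℂ} (hx : ‖x‖ < 1) (hy : ‖y‖ < 1) (hxy : ‖x + y‖ < 1) (n : ℕ) :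
    Complex.exp (∑' k, logTerm x y k n) =
      ((n : ℂ) + 1) * ((n : ℂ) + 1 - (x + y)) / (((n : ℂ) + 1 - x) * ((n : ℂ) + 1 - y)) := by
  have hn := natCast_add_one_ne_zero (𝕜 := ℂ) n
  have h1 := Complex.hasSum_taylorSeries_neg_log' (norm_div_natCast_add_one_lt hx n)
  have h2 := Complex.hasSum_taylorSeries_neg_log' (norm_div_natCast_add_one_lt hy n)
  have h3 := Complex.hasSum_taylorSeries_neg_log' (norm_div_natCast_add_one_lt hxy n)
  -- The linear terms of the three logarithm series cancel because x + y - (x + y) = 0, so the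
  -- combined series starts in degree 2, where ζ converges.
  have h4 := (hasSum_nat_add_iff' 1).2 ((h1.add h2).sub h3)
  have h5 : HasSum (fun k => logTerm x y k n) (-Complex.log (1 - x / ((n : ℂ) + 1))
      + -Complex.log (1 - y / ((n : ℂ) + 1)) - -Complex.log (1 - (x + y) / ((n : ℂ) + 1))) := by
    rw [sum_range_one] at h4
    have h6 := h4.congr_fun (g := fun k => logTerm x y k n) fun k => by
      have hk : (k : ℂ) + 2 ≠ 0 := by exact_mod_cast (k + 1).succ_ne_zero
      rw [logTerm]
      push_cast
      rw [div_pow, div_pow, div_pow, show (k : ℂ) + 1 + 1 = k + 2 by ring]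
      field_simp
    have e : (x / ((n : ℂ) + 1)) ^ (0 + 1) / (((0 : ℕ) : ℂ) + 1)
        + (y / ((n : ℂ) + 1)) ^ (0 + 1) / (((0 : ℕ) : ℂ) + 1)
        - ((x + y) / ((n : ℂ) + 1)) ^ (0 + 1) / (((0 : ℕ) : ℂ) + 1) = 0 := by
      push_cast
      ring
    rwa [e, sub_zero] at h6
  have n1 := natCast_add_one_sub_ne_zero hx n
  have n2 := natCast_add_one_sub_ne_zero hy n
  have n3 := natCast_add_one_sub_ne_zero hxy n
  have m1 : 1 - x / ((n : ℂ) + 1) ≠ 0 := by rw [one_sub_div hn]; exact div_ne_zero n1 hn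
  have m2 : 1 - y / ((n : ℂ) + 1) ≠ 0 := by rw [one_sub_div hn]; exact div_ne_zero n2 hn
  have m3 : 1 - (x + y) / ((n : ℂ) + 1) ≠ 0 := by rw [one_sub_div hn]; exact div_ne_zero n3 hn
  rw [h5.tsum_eq, sub_neg_eq_add, Complex.exp_add, Complex.exp_add, Complex.exp_neg,
    Complex.exp_neg, Complex.exp_log m1, Complex.exp_log m2, Complex.exp_log m3,
    one_sub_div hn, one_sub_div hn, one_sub_div hn]
  field_simp

theorem hasSum_zeta (k : ℕ) :
    HasSum (fun n : ℕ => 1 / ((n : ℂ) + 1) ^ (k + 2)) (riemannZeta ((k : ℂ) + 2)) := by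
  have hs : Summable (fun n : ℕ => 1 / (n : ℂ) ^ (k + 2)) := by
    have := (Complex.ofRealCLM.summable (Real.summable_one_div_nat_pow (p := k + 2).2 (by omega)))
    simpa using this
  have h := hs.hasSum
  rw [← zeta_nat_eq_tsum_of_gt_one (by omega : 1 < k + 2)] at h
  have h2 := (hasSum_nat_add_iff' 1).2 h
  simpa using h2

theorem summable_logTerm {x y : ℂ} (hx : ‖x‖ < 1) (hy : ‖y‖ < 1) (hxy : ‖x + y‖ < 1) :
    Summable (fun p : ℕ × ℕ => logTerm x y p.1 p.2) := by
  have g : ∀ z : ℂ, ‖z‖ < 1 → Summable fun k : ℕ => ‖z‖ ^ (k + 2) := fun z hz =>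
    (summable_nat_add_iff 2).2 (summable_geometric_of_lt_one (norm_nonneg z) hz)
  have s1 := ((g x hx).add (g y hy)).add (g _ hxy)
  have s2 := (summable_nat_add_iff 1).2 (Real.summable_one_div_nat_pow (p := 2).2 (by omega))
  refine Summable.of_norm_bounded (s1.mul_of_nonneg s2 (fun k => by positivity)
    fun n => by positivity) fun p => ?_
  rw [logTerm, norm_mul]
  refine mul_le_mul ?_ ?_ (norm_nonneg _) (by positivity)
  · rw [norm_div]
    have h2 : ‖(p.1 : ℂ) + 2‖ = (p.1 : ℝ) + 2 := by
      have := Complex.norm_natCast (p.1 + 2)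
      push_cast at this
      exact this
    rw [h2]
    refine (div_le_self (norm_nonneg _) (by linarith [Nat.cast_nonneg (α := ℝ) p.1])).trans ?_
    refine (norm_sub_le _ _).trans ?_
    rw [norm_pow]
    refine add_le_add_left ((norm_add_le _ _).trans ?_) _
    rw [norm_pow, norm_pow]
  · rw [norm_div, norm_one, norm_pow, norm_natCast_add_one]
    push_cast
    refine one_div_le_one_div_of_le (by positivity) ?_
    exact pow_le_pow_right₀ (by linarith [Nat.cast_nonneg (α := ℝ) p.2]) (by omega)

theorem hasSum_logTerm_right (x y : ℂ) (k : ℕ) :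
    HasSum (fun n => logTerm x y k n) (riemannZeta ((k : ℂ) + 2) *
        ((x ^ (k + 2) + y ^ (k + 2) - (x + y) ^ (k + 2)) / ((k : ℂ) + 2))) := by
  rw [mul_comm]
  exact (hasSum_zeta k).mul_left _

theorem hasSum_log {x y : ℂ} (hx : ‖x‖ < 1) (hy : ‖y‖ < 1) (hxy : ‖x + y‖ < 1) :
    HasSum (fun n : ℕ => riemannZeta ((n : ℂ) + 2) *
        ((x ^ (n + 2) + y ^ (n + 2) - (x + y) ^ (n + 2)) / ((n : ℂ) + 2)))
      (∑' n, ∑' k, logTerm x y k n) := by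
  have hs := summable_logTerm hx hy hxy
  have h1 := hs.hasSum.prod_fiberwise fun k => hasSum_logTerm_right x y k
  have hs' := (Equiv.prodComm ℕ ℕ).summable_iff.2 hs
  have h2 := ((Equiv.prodComm ℕ ℕ).hasSum_iff.2 hs.hasSum).prod_fiberwise
    fun n => (hs'.prod_factor n).hasSum
  rw [← h2.tsum_eq] at h1
  exact h1

theorem tsum_gaussTerm_eq_exp {x y : ℂ} (hx : ‖x‖ < 1) (hy : ‖y‖ < 1) (hxy : ‖x + y‖ < 1) :
    ∑' n, gaussTerm x y (1 - x) n = Complex.exp (∑' n, ∑' k, logTerm x y k n) := by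
  have hs := summable_logTerm hx hy hxy
  have hs' := (Equiv.prodComm ℕ ℕ).summable_iff.2 hs
  have h2 := (((Equiv.prodComm ℕ ℕ).hasSum_iff.2 hs.hasSum).prod_fiberwise
    fun n => (hs'.prod_factor n).hasSum).summable.hasSum.tendsto_sum_nat
  have h3 := ((Complex.continuous_exp.tendsto _).comp h2).mul (tendsto_tsum_gaussTerm hx hy)
  rw [mul_one] at h3
  refine tendsto_nhds_unique (tendsto_const_nhds.congr fun M => ?_) h3
  rw [tsum_gaussTerm_eq_prod_mul hx hy M]
  congr 1
  simp only [Function.comp, Complex.exp_sum]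
  exact prod_congr rfl fun n _ => (exp_tsum_logTerm hx hy hxy n).symm

/-- The Aomoto–Drinfeld–Zagier formula. -/
theorem hasSum_multiZeta_generating {x y : ℂ} (hx : ‖x‖ < 1) (hy : ‖y‖ < 1)
    (hxy : ‖x + y‖ < 1) :
    HasSum (fun q : ℕ × ℕ =>
        (multiZeta ((q.1 + 2) :: List.replicate q.2 1) : ℂ) * x ^ (q.1 + 1) * y ^ (q.2 + 1))
      (1 - Complex.exp (∑' n : ℕ, riemannZeta ((n : ℂ) + 2) *
        ((x ^ (n + 2) + y ^ (n + 2) - (x + y) ^ (n + 2)) / ((n : ℂ) + 2)))) := by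
  rw [(hasSum_log hx hy hxy).tsum_eq, ← tsum_gaussTerm_eq_exp hx hy hxy]
  convert hasSum_multiZeta_double hx hy using 1
  have hs : Summable (gaussTerm x y (1 - x)) := (summable_norm_gaussTerm hx hy).of_norm
  rw [hs.tsum_eq_zero_add]
  simp_rw [gaussTerm_succ_eq hx y]
  rw [tsum_neg]
  simp [gaussTerm]

/-! ### Taylor coefficients along x = zu, y = z, and membership in the zeta algebra. -/

section

open Polynomial

theorem iteratedDeriv_of_hasSum {f : ℂ → ℂ} {a : ℕ → ℂ}
    (h : ∀ᶠ z in 𝓝 (0 : ℂ), HasSum (fun n => z ^ n * a n) (f z)) :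
    AnalyticAt ℂ f 0 ∧ ∀ n, iteratedDeriv n f 0 = (n.factorial : ℂ) * a n := by
  have h1 : HasFPowerSeriesAt f (FormalMultilinearSeries.ofScalars ℂ a) 0 := by
    rw [hasFPowerSeriesAt_iff]
    simpa [FormalMultilinearSeries.coeff_ofScalars] using h
  refine ⟨h1.analyticAt, fun n => ?_⟩
  have h2 := h1.eq_formalMultilinearSeries h1.analyticAt.hasFPowerSeriesAt
  have h3 := congrArg (fun p => p.coeff n) h2
  simp only [FormalMultilinearSeries.coeff_ofScalars] at h3
  have : (n.factorial : ℂ) ≠ 0 := by exact_mod_cast n.factorial_ne_zero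
  rw [h3]
  field_simp

/-- The recurrence for the Taylor coefficients of an exponential. -/
theorem exp_coeff_recurrence {f : ℂ → ℂ} {a b : ℕ → ℂ}
    (ha : ∀ᶠ z in 𝓝 (0 : ℂ), HasSum (fun n => z ^ n * a n) (f z))
    (hb : ∀ᶠ z in 𝓝 (0 : ℂ), HasSum (fun n => z ^ n * b n) (Complex.exp (f z))) (n : ℕ) :
    ((n : ℂ) + 1) * b (n + 1)
      = ∑ k ∈ range (n + 1), ((k : ℂ) + 1) * a (k + 1) * b (n - k) := by
  obtain ⟨fa, ha⟩ := iteratedDeriv_of_hasSum ha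
  obtain ⟨ga, hb⟩ := iteratedDeriv_of_hasSum hb
  -- Differentiating g = exp f gives g' = f' g near 0; the Leibniz rule for the n-th derivative at 0
  -- is the recurrence.
  have h1 : deriv (fun z => Complex.exp (f z))
      =ᶠ[𝓝 0] deriv f * fun z => Complex.exp (f z) := by
    filter_upwards [fa.eventually_analyticAt] with z hz
    rw [Pi.mul_apply, mul_comm]
    exact hz.differentiableAt.hasDerivAt.cexp.deriv
  have h2 := hb (n + 1)
  rw [iteratedDeriv_succ', h1.iteratedDeriv_eq,
    iteratedDeriv_mul fa.deriv.contDiffAt ga.contDiffAt] at h2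
  have hn : (n.factorial : ℂ) ≠ 0 := by exact_mod_cast n.factorial_ne_zero
  refine mul_left_cancel₀ hn ?_
  rw [← mul_assoc, mul_comm (n.factorial : ℂ), ← Nat.cast_succ, ← Nat.cast_mul,
    ← Nat.factorial_succ, ← h2, mul_sum]
  refine sum_congr rfl fun k hk => ?_
  rw [← iteratedDeriv_succ', ha, hb,
    ← Nat.choose_mul_factorial_mul_factorial (Nat.le_of_lt_succ (mem_range.1 hk)),
    Nat.factorial_succ]
  push_cast
  ring

theorem hasSum_zetaValue (k : ℕ) (hk : 2 ≤ k) :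
    HasSum (fun n : ℕ => 1 / ((n : ℝ) + 1) ^ k) (zetaValue k) := by
  have h := (Real.summable_one_div_nat_pow (p := k).2 (by omega)).hasSum
  rw [← zetaValue_eq_tsum hk] at h
  have h2 := (hasSum_nat_add_iff' 1).2 h
  simpa [show k ≠ 0 by omega] using h2

theorem multiZeta_singleton (m : ℕ) (hm : 2 ≤ m) : multiZeta [m] = zetaValue m := by
  have h := (hasSum_multiZeta 0 m hm).1
  simp only [elemHarmonic_zero] at h
  exact h.unique (hasSum_zetaValue m hm)

theorem riemannZeta_eq_zetaValue (k : ℕ) : riemannZeta ((k : ℂ) + 2) = (zetaValue (k + 2) : ℝ) := by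
  refine (hasSum_zeta k).unique ?_
  have := Complex.hasSum_ofReal.2 (hasSum_zetaValue (k + 2) (by omega))
  simpa using this

/-- The homogeneous components of the logarithm of the generating function, dehomogenized. -/
noncomputable def logPoly : ℕ → ℝ[X]
  | 0 => 0
  | 1 => 0
  | n + 2 => C (zetaValue (n + 2) / ((n : ℝ) + 2)) * (X ^ (n + 2) + 1 - (X + 1) ^ (n + 2))

/-- The homogeneous components of the generating function, dehomogenized. -/
noncomputable def genPoly : ℕ → ℝ[X]
  | 0 => 1
  | 1 => 0
  | n + 2 => -∑ p ∈ antidiagonal n, C (multiZeta ((p.1 + 2) :: List.replicate p.2 1)) * X ^ (p.1 + 1)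

theorem eventually_norm_lt (u : ℝ) :
    ∀ᶠ z : ℂ in 𝓝 0, ‖z * u‖ < 1 ∧ ‖z‖ < 1 ∧ ‖z * u + z‖ < 1 := by
  have h1 : Tendsto (fun z : ℂ => ‖z * u‖) (𝓝 0) (𝓝 (0 : ℝ)) :=
    (by fun_prop : Continuous fun z : ℂ => ‖z * u‖).tendsto' 0 0 (by simp)
  have h2 : Tendsto (fun z : ℂ => ‖z‖) (𝓝 0) (𝓝 (0 : ℝ)) :=
    (by fun_prop : Continuous fun z : ℂ => ‖z‖).tendsto' 0 0 (by simp)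
  have h3 : Tendsto (fun z : ℂ => ‖z * u + z‖) (𝓝 0) (𝓝 (0 : ℝ)) :=
    (by fun_prop : Continuous fun z : ℂ => ‖z * u + z‖).tendsto' 0 0 (by simp)
  filter_upwards [h1.eventually_lt_const one_pos, h2.eventually_lt_const one_pos,
    h3.eventually_lt_const one_pos] with z a b c using ⟨a, b, c⟩

theorem hasSum_logPoly (u : ℝ) {z : ℂ} (h1 : ‖z * u‖ < 1) (h2 : ‖z‖ < 1) (h3 : ‖z * u + z‖ < 1) :
    HasSum (fun n => z ^ n * ((logPoly n).eval u : ℝ)) (∑' n, ∑' k, logTerm (z * u) z k n) := by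
  have h := hasSum_log h1 h2 h3
  rw [← hasSum_nat_add_iff' 2]
  simp only [sum_range_succ, sum_range_zero, logPoly, eval_zero, Complex.ofReal_zero, mul_zero,
    add_zero, sub_zero]
  refine h.congr_fun fun n => ?_
  rw [riemannZeta_eq_zetaValue]
  simp only [eval_mul, eval_C, eval_sub, eval_add, eval_pow, eval_X, eval_one]
  push_cast
  rw [show z * u + z = z * (u + 1) by ring, mul_pow, mul_pow]
  ring

/-- The double series is regrouped along antidiagonals: the term indexed by (p, q) has total degree
p + q + 2 in z. -/
theorem hasSum_genPoly (u : ℝ) {z : ℂ} (h1 : ‖z * u‖ < 1) (h2 : ‖z‖ < 1) (h3 : ‖z * u + z‖ < 1) :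
    HasSum (fun n => z ^ n * ((genPoly n).eval u : ℝ))
      (Complex.exp (∑' n, ∑' k, logTerm (z * u) z k n)) := by
  have h := hasSum_multiZeta_generating h1 h2 h3
  rw [(hasSum_log h1 h2 h3).tsum_eq] at h
  have h' := ((Finset.HasAntidiagonal.sigmaAntidiagonalEquivProd (A := ℕ)).hasSum_iff.2 h).sigma
    fun n => hasSum_fintype _
  rw [← hasSum_nat_add_iff' 2]
  have h'' := h'.neg
  rw [neg_sub] at h''
  simp only [sum_range_succ, sum_range_zero, genPoly, eval_zero, Complex.ofReal_zero, mul_zero,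
    add_zero, zero_add, eval_one, Complex.ofReal_one, mul_one, pow_zero]
  refine h''.congr_fun fun n => ?_
  rw [eval_neg, eval_finsetSum]
  simp only [eval_mul, eval_C, eval_pow, eval_X]
  push_cast
  rw [mul_neg, mul_sum, ← Finset.sum_finset_coe]
  congr 1
  refine sum_congr rfl fun p _ => ?_
  have hp := HasAntidiagonal.mem_antidiagonal.1 p.2
  simp only [Function.comp, Finset.HasAntidiagonal.sigmaAntidiagonalEquivProd_apply]
  rw [show z ^ (n + 2) = z ^ ((p : ℕ × ℕ).1 + 1) * z ^ ((p : ℕ × ℕ).2 + 1) by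
    rw [← pow_add]; congr 1; omega, mul_pow]
  ring

/-- The Taylor recurrence holds at every real u, and real polynomials agreeing at all points are
equal. -/
theorem genPoly_recurrence (n : ℕ) :
    ((n : ℝ[X]) + 1) * genPoly (n + 1)
      = ∑ k ∈ range (n + 1), ((k : ℝ[X]) + 1) * logPoly (k + 1) * genPoly (n - k) := by
  refine Polynomial.funext fun u => ?_
  have h := exp_coeff_recurrence
    (f := fun z : ℂ => ∑' n, ∑' k, logTerm (z * (u : ℂ)) z k n)
    (a := fun n => ((logPoly n).eval u : ℝ)) (b := fun n => ((genPoly n).eval u : ℝ))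
    ((eventually_norm_lt u).mono fun z hz =>
      hasSum_logPoly u hz.1 hz.2.1 hz.2.2)
    ((eventually_norm_lt u).mono fun z hz =>
      hasSum_genPoly u hz.1 hz.2.1 hz.2.2) n
  simp only [eval_finsetSum, eval_mul, eval_add, eval_natCast, eval_one]
  exact_mod_cast h

theorem coeff_genPoly (p q : ℕ) :
    (genPoly (p + q + 2)).coeff (p + 1) = -multiZeta ((p + 2) :: List.replicate q 1) := by
  rw [genPoly, coeff_neg, finsetSum_coeff, sum_eq_single (p, q)]
  · simp
  · intro b hb hne
    rw [HasAntidiagonal.mem_antidiagonal] at hb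
    rw [coeff_C_mul, coeff_X_pow, if_neg, mul_zero]
    intro h
    apply hne
    ext <;> simp <;> omega
  · intro h
    simp at h

/-- Neither generating function has a part of weight 1, so in weight 3 the recurrence has no product
terms and says that the two components agree; compare coefficients of X. It turns the ζ(2,1)
contained in `shiftConst 2` into the ζ(3) of the formula for W_{4,r}. -/
theorem multiZeta_two_one : multiZeta [2, 1] = zetaValue 3 := by
  have h := congrArg (fun P => P.coeff 1) (genPoly_recurrence 2)
  have h0 := coeff_genPoly 0 1
  simp only [zero_add, Nat.reduceAdd, List.replicate_one] at h0
  rw [← neg_eq_iff_eq_neg.2 h0]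
  simp only [sum_range_succ, sum_range_zero, logPoly, mul_zero, zero_mul, zero_add,
    Nat.sub_self, Nat.reduceAdd, genPoly.eq_1, genPoly.eq_2, mul_one, Nat.reduceSub] at h
  rw [← Nat.cast_succ, ← C_eq_natCast, coeff_C_mul, coeff_C_mul, coeff_C_mul] at h
  simp [coeff_X_add_one_pow, coeff_X_pow, coeff_one] at h

  linarith

theorem ratCast_mem_zetaAlgebra (q : ℚ) : (q : ℝ) ∈ zetaAlgebra :=
  zetaAlgebra.algebraMap_mem q

theorem zetaValue_mem_zetaAlgebra {s : ℕ} (hs : 2 ≤ s) : zetaValue s ∈ zetaAlgebra :=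
  Algebra.subset_adjoin ⟨s, hs, rfl⟩

theorem coeff_mul_mem {A : Subalgebra ℚ ℝ} {P Q : ℝ[X]} (hP : ∀ i, P.coeff i ∈ A)
    (hQ : ∀ i, Q.coeff i ∈ A) (i : ℕ) : (P * Q).coeff i ∈ A := by
  rw [coeff_mul]
  exact sum_mem fun p _ => mul_mem (hP _) (hQ _)

theorem coeff_logPoly_mem (n i : ℕ) : (logPoly n).coeff i ∈ zetaAlgebra := by
  match n with
  | 0 => simp [logPoly]
  | 1 => simp [logPoly]
  | n + 2 =>
    rw [logPoly, coeff_C_mul, div_eq_mul_inv, mul_assoc]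
    refine mul_mem (zetaValue_mem_zetaAlgebra (by omega)) (mul_mem ?_ ?_)
    · have := ratCast_mem_zetaAlgebra (((n : ℚ) + 2)⁻¹)
      push_cast at this
      exact this
    · rw [coeff_sub, coeff_add, coeff_X_add_one_pow, coeff_X_pow, coeff_one]
      refine sub_mem (add_mem ?_ ?_) (natCast_mem _ _)
      · split_ifs <;> simp
      · split_ifs <;> simp

/-- The recurrence expresses weight n+1 through lower weights and the logarithm, dividing only by
n+1. -/
theorem coeff_genPoly_mem (n i : ℕ) : (genPoly n).coeff i ∈ zetaAlgebra := by
  induction n using Nat.strong_induction_on generalizing i with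
  | _ n ih =>
    match n with
    | 0 =>
      rw [genPoly, coeff_one]
      split_ifs <;> simp
    | n + 1 =>
      have h := congrArg (fun P => P.coeff i) (genPoly_recurrence n)
      simp only [finsetSum_coeff] at h
      rw [← Nat.cast_succ, ← C_eq_natCast, coeff_C_mul] at h
      have hn : ((n + 1 : ℕ) : ℝ) ≠ 0 := by positivity
      rw [← inv_mul_cancel_left₀ hn ((genPoly (n + 1)).coeff i), h]
      have hq := ratCast_mem_zetaAlgebra (((n + 1 : ℕ) : ℚ)⁻¹)
      rw [Rat.cast_inv, Rat.cast_natCast] at hq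
      refine mul_mem hq (sum_mem fun k hk => ?_)
      refine coeff_mul_mem (fun j => ?_) (fun j => ih _ (by omega) j) i
      rw [← Nat.cast_succ, ← C_eq_natCast, coeff_C_mul]
      exact mul_mem (natCast_mem _ _) (coeff_logPoly_mem _ _)

theorem multiZeta_mem_zetaAlgebra (k m : ℕ) (hm : 2 ≤ m) :
    multiZeta (m :: List.replicate k 1) ∈ zetaAlgebra := by
  obtain ⟨p, rfl⟩ := Nat.exists_eq_add_of_le' hm
  rw [← neg_mem_iff, ← coeff_genPoly]
  exact coeff_genPoly_mem _ _

end

/-! ### The series W and the sums ∑ e_k(n) / (n^m (n+i)). -/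

/-- `∑ e_k(1, …, 1/n) / n^m`. -/
noncomputable def elemZeta (k m : ℕ) : ℝ :=
  ∑' n : ℕ, elemHarmonic k (n + 1) / ((n : ℝ) + 1) ^ m

theorem hasSum_elemZeta (k m : ℕ) (hm : 2 ≤ m) :
    HasSum (fun n : ℕ => elemHarmonic k (n + 1) / ((n : ℝ) + 1) ^ m) (elemZeta k m) :=
  (summable_elemHarmonic_shift k 1 m hm).hasSum

theorem WTerm_succ_eq (k r m n : ℕ) :
    WTerm (k + 1) r m (n + 1) = elemHarmonic k (n + 1 + r) / ((n : ℝ) + 1) ^ m := by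
  rw [WTerm, ← div_div, stirlingFirst_div_factorial]
  push_cast
  rfl

theorem summable_WTerm (k r m : ℕ) (hk : 1 ≤ k) (hm : 2 ≤ m) :
    Summable (fun n : ℕ => WTerm k r m (n + 1)) := by
  obtain ⟨k, rfl⟩ := Nat.exists_eq_add_of_le' hk
  refine (summable_elemHarmonic_shift k (1 + r) m hm).congr fun n => ?_
  rw [WTerm_succ_eq, add_assoc]

theorem W_eq_of_hasSum {k r m : ℕ} {s : ℝ}
    (h : HasSum (fun n : ℕ => elemHarmonic k (n + 1 + r) / ((n : ℝ) + 1) ^ m) s) :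
    W (k + 1) r m = k.factorial * s := by
  rw [W, Nat.add_sub_cancel, tsum_congr (WTerm_succ_eq k r m), h.tsum_eq]

theorem W_zero_eq (k m : ℕ) (hm : 2 ≤ m) : W (k + 1) 0 m = k.factorial * elemZeta k m :=
  W_eq_of_hasSum (hasSum_elemZeta k m hm)

theorem elemZeta_zero (m : ℕ) (hm : 2 ≤ m) : elemZeta 0 m = zetaValue m := by
  simpa [elemZeta] using (hasSum_zetaValue m hm).tsum_eq

theorem elemZeta_succ (k m : ℕ) (hm : 2 ≤ m) :
    elemZeta (k + 1) m = multiZeta ((m + 1) :: List.replicate k 1)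
      + multiZeta (m :: List.replicate (k + 1) 1) := by
  refine (hasSum_elemZeta (k + 1) m hm).unique ?_
  refine ((hasSum_multiZeta k (m + 1) (by omega)).1.add
    (hasSum_multiZeta (k + 1) m hm).1).congr_fun fun n => ?_
  rw [elemHarmonic_succ_succ]
  have : (n : ℝ) + 1 ≠ 0 := by positivity
  field_simp
  ring

theorem elemZeta_mem_zetaAlgebra (k m : ℕ) (hm : 2 ≤ m) : elemZeta k m ∈ zetaAlgebra := by
  cases k with
  | zero => rw [elemZeta_zero m hm]; exact zetaValue_mem_zetaAlgebra hm
  | succ k =>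
    rw [elemZeta_succ k m hm]
    exact add_mem (multiZeta_mem_zetaAlgebra _ _ (by omega)) (multiZeta_mem_zetaAlgebra _ _ hm)

/-- The value of `∑ e_k(1, …, 1/n) / (n^m (n + i))`. -/
noncomputable def shiftZeta (k m : ℕ) : ℕ → ℝ :=
  ∑ l ∈ Icc 1 (m - 1), ((-1) ^ (l - 1) * elemZeta k (m + 1 - l)) • (fun i : ℕ => 1 / (i : ℝ) ^ l)
    + ((-1 : ℝ) ^ (m - 1)) • (fun i : ℕ => shiftConst k i / (i : ℝ) ^ m)

/-- This mirrors 1/(n^{m+2}(n+i)) = (1/n^{m+2} - 1/(n^{m+1}(n+i)))/i, the step that drives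
`hasSum_shiftZeta`. -/
theorem shiftZeta_succ (k m i : ℕ) :
    shiftZeta k (m + 2) i = (elemZeta k (m + 2) - shiftZeta k (m + 1) i) / (i : ℝ) := by
  simp only [shiftZeta, Pi.add_apply, Finset.sum_apply, Pi.smul_apply, smul_eq_mul,
    sum_Icc_one_eq_sum_range, Nat.add_sub_cancel, Nat.add_sub_add_right,
    show m + 2 - 1 = m + 1 by omega]
  have e : ∑ l ∈ range m, (-1 : ℝ) ^ (l + 1) * elemZeta k (m + 2 - (l + 1)) * (1 / (i : ℝ) ^ (l + 1 + 1))
      = -(∑ l ∈ range m, (-1 : ℝ) ^ l * elemZeta k (m + 1 - l) * (1 / (i : ℝ) ^ (l + 1))) / i := by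
    rw [neg_div, sum_div, ← sum_neg_distrib]
    refine sum_congr rfl fun l _ => ?_
    rw [show m + 2 - (l + 1) = m + 1 - l by omega]
    ring
  rw [sum_range_succ', e, Nat.sub_zero]
  generalize ∑ l ∈ range m, (-1 : ℝ) ^ l * elemZeta k (m + 1 - l) * (1 / (i : ℝ) ^ (l + 1)) = t
  ring

theorem hasSum_shiftZeta (k m i : ℕ) (hi : i ≠ 0) :
    HasSum (fun n : ℕ => elemHarmonic k (n + 1) / ((n : ℝ) + 1) ^ (m + 1) *
      (1 / ((n : ℝ) + 1 + i))) (shiftZeta k (m + 1) i) := by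
  have hi' : (i : ℝ) ≠ 0 := by exact_mod_cast hi
  induction m with
  | zero =>
    have h := (hasSum_elemHarmonic_succ_mul_sub k i hi).div_const (i : ℝ)
    have e : shiftZeta k (0 + 1) i = shiftConst k i / (i : ℝ) := by simp [shiftZeta]
    rw [e]
    refine h.congr_fun fun n => ?_
    have h1 : (n : ℝ) + 1 ≠ 0 := by positivity
    have h2 : (n : ℝ) + 1 + i ≠ 0 := by positivity
    field_simp
    ring
  | succ m ih =>
    rw [shiftZeta_succ]
    refine (((hasSum_elemZeta k (m + 2) (by omega)).sub ih).div_const (i : ℝ)).congr_fun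
      fun n => ?_
    have h1 : (n : ℝ) + 1 ≠ 0 := by positivity
    have h2 : (n : ℝ) + 1 + i ≠ 0 := by positivity
    field_simp
    ring

/-! ### Divided-difference functionals and the expansion of e_k(n+r). -/

/-- `g ↦ ∑_{i ≤ r} g i`. -/
noncomputable def singleSum (r : ℕ) : (ℕ → ℝ) →ₗ[ℝ] ℝ where
  toFun g := ∑ i ∈ Icc 1 r, g i
  map_add' g h := by simp [sum_add_distrib]
  map_smul' c g := by simp [mul_sum]

/-- The sum over all pairs of the negatives of the first divided differences of `g`. -/
noncomputable def pairSum (r : ℕ) : (ℕ → ℝ) →ₗ[ℝ] ℝ where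
  toFun g := sumPairs r fun i j => 1 / ((j : ℝ) - (i : ℝ)) * (g i - g j)
  map_add' g h := by
    simp only [sumPairs, Pi.add_apply, ← sum_add_distrib]
    exact sum_congr rfl fun _ _ => sum_congr rfl fun _ _ => by ring
  map_smul' c g := by
    simp only [sumPairs, Pi.smul_apply, smul_eq_mul, mul_sum, RingHom.id_apply]
    exact sum_congr rfl fun _ _ => sum_congr rfl fun _ _ => by ring

/-- The sum over all triples of the second divided differences of `g`. -/
noncomputable def tripleSum (r : ℕ) : (ℕ → ℝ) →ₗ[ℝ] ℝ where
  toFun g := sumTriples r fun i j k =>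
    g i / (((j : ℝ) - (i : ℝ)) * ((k : ℝ) - (i : ℝ)))
      + g j / (((i : ℝ) - (j : ℝ)) * ((k : ℝ) - (j : ℝ)))
      + g k / (((j : ℝ) - (k : ℝ)) * ((i : ℝ) - (k : ℝ)))
  map_add' g h := by
    simp only [sumTriples, Pi.add_apply, ← sum_add_distrib]
    exact sum_congr rfl fun _ _ => sum_congr rfl fun _ _ => sum_congr rfl fun _ _ => by ring
  map_smul' c g := by
    simp only [sumTriples, Pi.smul_apply, smul_eq_mul, mul_sum, RingHom.id_apply]
    exact sum_congr rfl fun _ _ => sum_congr rfl fun _ _ => sum_congr rfl fun _ _ => by ring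

theorem singleSum_apply (r : ℕ) (g : ℕ → ℝ) : singleSum r g = ∑ i ∈ Icc 1 r, g i := rfl

theorem pairSum_apply (r : ℕ) (g : ℕ → ℝ) :
    pairSum r g = sumPairs r fun i j => 1 / ((j : ℝ) - (i : ℝ)) * (g i - g j) := rfl

theorem tripleSum_apply (r : ℕ) (g : ℕ → ℝ) : tripleSum r g = sumTriples r fun i j k =>
    g i / (((j : ℝ) - (i : ℝ)) * ((k : ℝ) - (i : ℝ)))
      + g j / (((i : ℝ) - (j : ℝ)) * ((k : ℝ) - (j : ℝ)))
      + g k / (((j : ℝ) - (k : ℝ)) * ((i : ℝ) - (k : ℝ))) := rfl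

theorem sumPairs_succ (r : ℕ) (f : ℕ → ℕ → ℝ) :
    sumPairs (r + 1) f = sumPairs r f + ∑ i ∈ Icc 1 r, f i (r + 1) := by
  rw [sumPairs, Finset.sum_Icc_succ_top (by omega)]
  rfl

theorem sumTriples_succ (r : ℕ) (f : ℕ → ℕ → ℕ → ℝ) :
    sumTriples (r + 1) f = sumTriples r f + sumPairs r (fun i j => f i j (r + 1)) := by
  rw [sumTriples, Finset.sum_Icc_succ_top (by omega)]
  rfl

theorem singleSum_succ (r : ℕ) (g : ℕ → ℝ) : singleSum (r + 1) g = singleSum r g + g (r + 1) := by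
  rw [singleSum_apply, Finset.sum_Icc_succ_top (by omega)]
  rfl

/-- With N = n+1, the negated divided difference of i ↦ 1/(N+i) at two points i, j is
1/((N+i)(N+j)). The functional therefore gives e_2 of 1/(N+1), …, 1/(N+r), and this is its Pascal
rule. `tripleSum_succ` is the analogue for e_3. -/
theorem pairSum_succ (r n : ℕ) :
    pairSum (r + 1) (fun i => 1 / ((n : ℝ) + 1 + i)) = pairSum r (fun i => 1 / ((n : ℝ) + 1 + i))
      + singleSum r (fun i => 1 / ((n : ℝ) + 1 + i)) / ((n : ℝ) + 1 + r + 1) := by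
  rw [pairSum_apply, sumPairs_succ, ← pairSum_apply, singleSum_apply, sum_div]
  congr 1
  refine sum_congr rfl fun i hi => ?_
  have hi' : i < r + 1 := Nat.lt_succ_of_le (mem_Icc.1 hi).2
  have h1 : ((r + 1 : ℕ) : ℝ) - i ≠ 0 := sub_ne_zero.2 (by exact_mod_cast hi'.ne')
  have h2 : (n : ℝ) + 1 + i ≠ 0 := by positivity
  have h3 : (n : ℝ) + 1 + r + 1 ≠ 0 := by positivity
  push_cast at h1 ⊢
  rw [← add_assoc]
  field_simp
  ring

theorem tripleSum_succ (r n : ℕ) :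
    tripleSum (r + 1) (fun i => 1 / ((n : ℝ) + 1 + i))
      = tripleSum r (fun i => 1 / ((n : ℝ) + 1 + i))
        + pairSum r (fun i => 1 / ((n : ℝ) + 1 + i)) / ((n : ℝ) + 1 + r + 1) := by
  rw [tripleSum_apply, sumTriples_succ, ← tripleSum_apply, pairSum_apply]
  congr 1
  simp only [sumPairs, sum_div]
  refine sum_congr rfl fun j hj => sum_congr rfl fun i hi => ?_
  have hj' : j < r + 1 := Nat.lt_succ_of_le (mem_Icc.1 hj).2
  have hi' : i < j := (mem_Ico.1 hi).2
  have h1 : ((r + 1 : ℕ) : ℝ) - j ≠ 0 := sub_ne_zero.2 (by exact_mod_cast hj'.ne')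
  have h2 : ((r + 1 : ℕ) : ℝ) - i ≠ 0 := sub_ne_zero.2 (by exact_mod_cast (hi'.trans hj').ne')
  have h3 : (j : ℝ) - i ≠ 0 := sub_ne_zero.2 (by exact_mod_cast hi'.ne')
  have h4 : (n : ℝ) + 1 + i ≠ 0 := by positivity
  have h5 : (n : ℝ) + 1 + j ≠ 0 := by positivity
  have h6 : (n : ℝ) + 1 + r + 1 ≠ 0 := by positivity
  rw [← neg_sub (j : ℝ) i, ← neg_sub ((r + 1 : ℕ) : ℝ) i, ← neg_sub ((r + 1 : ℕ) : ℝ) j]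
  push_cast at h1 h2 ⊢
  rw [← add_assoc]
  field_simp
  ring

/-- This and the next two lemmas are e_k(A ∪ B) = ∑ e_{k-s}(A) e_s(B) for the blocks A = {1, …,
1/(n+1)} and B = {1/(n+2), …, 1/(n+1+r)}. -/
theorem elemHarmonic_one_shift (n r : ℕ) :
    elemHarmonic 1 (n + 1 + r) = elemHarmonic 1 (n + 1)
      + singleSum r (fun i => 1 / ((n : ℝ) + 1 + i)) := by
  induction r with
  | zero => simp [singleSum_apply]
  | succ r ih =>
    rw [← add_assoc, elemHarmonic_succ_succ, ih, singleSum_succ, elemHarmonic_zero]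
    push_cast
    ring

theorem elemHarmonic_two_shift (n r : ℕ) :
    elemHarmonic 2 (n + 1 + r) = elemHarmonic 2 (n + 1)
      + elemHarmonic 1 (n + 1) * singleSum r (fun i => 1 / ((n : ℝ) + 1 + i))
      + pairSum r (fun i => 1 / ((n : ℝ) + 1 + i)) := by
  induction r with
  | zero => simp [singleSum_apply, pairSum_apply, sumPairs]
  | succ r ih =>
    rw [← add_assoc, elemHarmonic_succ_succ, ih, singleSum_succ, pairSum_succ,
      elemHarmonic_one_shift]
    push_cast
    ring

theorem elemHarmonic_three_shift (n r : ℕ) :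
    elemHarmonic 3 (n + 1 + r) = elemHarmonic 3 (n + 1)
      + elemHarmonic 2 (n + 1) * singleSum r (fun i => 1 / ((n : ℝ) + 1 + i))
      + elemHarmonic 1 (n + 1) * pairSum r (fun i => 1 / ((n : ℝ) + 1 + i))
      + tripleSum r (fun i => 1 / ((n : ℝ) + 1 + i)) := by
  induction r with
  | zero => simp [singleSum_apply, pairSum_apply, sumPairs, tripleSum_apply, sumTriples]
  | succ r ih =>
    rw [← add_assoc, elemHarmonic_succ_succ, ih, singleSum_succ, pairSum_succ, tripleSum_succ,
      elemHarmonic_two_shift]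
    push_cast
    ring

theorem hasSum_singleSum (r : ℕ) {c : ℕ → ℝ} {F : ℕ → ℕ → ℝ} {A : ℕ → ℝ}
    (h : ∀ i, i ≠ 0 → HasSum (fun n => c n * F n i) (A i)) :
    HasSum (fun n => c n * singleSum r (F n)) (singleSum r A) := by
  simp only [singleSum_apply, mul_sum]
  exact hasSum_sum fun i hi => h i (by have := (mem_Icc.1 hi).1; omega)

theorem hasSum_pairSum (r : ℕ) {c : ℕ → ℝ} {F : ℕ → ℕ → ℝ} {A : ℕ → ℝ}
    (h : ∀ i, i ≠ 0 → HasSum (fun n => c n * F n i) (A i)) :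
    HasSum (fun n => c n * pairSum r (F n)) (pairSum r A) := by
  simp only [pairSum_apply, sumPairs, mul_sum]
  refine hasSum_sum fun j hj => hasSum_sum fun i hi => ?_
  have hj' := (mem_Icc.1 hj).1
  have hi' := (mem_Ico.1 hi).1
  refine (((h i (by omega)).sub (h j (by omega))).mul_left (1 / ((j : ℝ) - i))).congr_fun
    fun n => ?_
  ring

theorem hasSum_tripleSum (r : ℕ) {c : ℕ → ℝ} {F : ℕ → ℕ → ℝ} {A : ℕ → ℝ}
    (h : ∀ i, i ≠ 0 → HasSum (fun n => c n * F n i) (A i)) :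
    HasSum (fun n => c n * tripleSum r (F n)) (tripleSum r A) := by
  simp only [tripleSum_apply, sumTriples, mul_sum]
  refine hasSum_sum fun k hk => hasSum_sum fun j hj => hasSum_sum fun i hi => ?_
  have hk' := (mem_Icc.1 hk).1
  have hj' := (mem_Ico.1 hj).1
  have hi' := (mem_Ico.1 hi).1
  refine ((((h i (by omega)).div_const _).add ((h j (by omega)).div_const _)).add
    ((h k (by omega)).div_const _)).congr_fun fun n => ?_
  ring

/-! ### The formulas for W_{2,r}, W_{3,r} and W_{4,r}. -/

theorem W_two_eq (r m : ℕ) (hm : 2 ≤ m) :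
    W 2 r m = elemZeta 1 m + singleSum r (shiftZeta 0 m) := by
  obtain ⟨m, rfl⟩ := Nat.exists_eq_add_of_le' hm
  have h := (hasSum_elemZeta 1 (m + 2) hm).add (hasSum_singleSum r (hasSum_shiftZeta 0 (m + 1)))
  rw [W_eq_of_hasSum (h.congr_fun fun n => ?_)]
  · simp
  · rw [elemHarmonic_one_shift, elemHarmonic_zero]
    ring

theorem W_three_eq (r m : ℕ) (hm : 2 ≤ m) :
    W 3 r m = 2 * (elemZeta 2 m + singleSum r (shiftZeta 1 m) + pairSum r (shiftZeta 0 m)) := by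
  obtain ⟨m, rfl⟩ := Nat.exists_eq_add_of_le' hm
  have h := ((hasSum_elemZeta 2 (m + 2) hm).add
    (hasSum_singleSum r (hasSum_shiftZeta 1 (m + 1)))).add
    (hasSum_pairSum r (hasSum_shiftZeta 0 (m + 1)))
  rw [W_eq_of_hasSum (h.congr_fun fun n => ?_)]
  · simp [Nat.factorial]
  · rw [elemHarmonic_two_shift, elemHarmonic_zero]
    ring

theorem W_four_eq (r m : ℕ) (hm : 2 ≤ m) :
    W 4 r m = 6 * (elemZeta 3 m + singleSum r (shiftZeta 2 m) + pairSum r (shiftZeta 1 m)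
      + tripleSum r (shiftZeta 0 m)) := by
  obtain ⟨m, rfl⟩ := Nat.exists_eq_add_of_le' hm
  have h := (((hasSum_elemZeta 3 (m + 2) hm).add
    (hasSum_singleSum r (hasSum_shiftZeta 2 (m + 1)))).add
    (hasSum_pairSum r (hasSum_shiftZeta 1 (m + 1)))).add
    (hasSum_tripleSum r (hasSum_shiftZeta 0 (m + 1)))
  rw [W_eq_of_hasSum (h.congr_fun fun n => ?_)]
  · simp [Nat.factorial]
  · rw [elemHarmonic_three_shift, elemHarmonic_zero]
    ring

/-- As a function of i, `shiftZeta` is a linear combination of the powers 1/i^l and of `shiftConst k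
i / i^m`, so each functional can be evaluated termwise. The same holds for the pair and triple
functionals. -/
theorem singleSum_shiftZeta (r k m : ℕ) :
    singleSum r (shiftZeta k m)
      = ∑ l ∈ Icc 1 (m - 1), ((-1) ^ (l - 1) * elemZeta k (m + 1 - l)) * H l r
        + (-1 : ℝ) ^ (m - 1) * ∑ i ∈ Icc 1 r, shiftConst k i / (i : ℝ) ^ m := by
  simp only [shiftZeta, map_add, map_sum, map_smul, smul_eq_mul, singleSum_apply]
  rfl

theorem pairSum_shiftZeta (r k m : ℕ) :
    pairSum r (shiftZeta k m)
      = ∑ l ∈ Icc 1 (m - 1), ((-1) ^ (l - 1) * elemZeta k (m + 1 - l)) *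
          sumPairs r (fun i j => 1 / ((j : ℝ) - (i : ℝ)) * (1 / (i : ℝ) ^ l - 1 / (j : ℝ) ^ l))
        + (-1 : ℝ) ^ (m - 1) * sumPairs r (fun i j => 1 / ((j : ℝ) - (i : ℝ)) *
            (shiftConst k i / (i : ℝ) ^ m - shiftConst k j / (j : ℝ) ^ m)) := by
  simp only [shiftZeta, map_add, map_sum, map_smul, smul_eq_mul, pairSum_apply]

theorem tripleSum_shiftZeta (r k m : ℕ) :
    tripleSum r (shiftZeta k m)
      = ∑ l ∈ Icc 1 (m - 1), ((-1) ^ (l - 1) * elemZeta k (m + 1 - l)) *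
          sumTriples r (fun i j k =>
              1 / ((i : ℝ) ^ l * ((j : ℝ) - (i : ℝ)) * ((k : ℝ) - (i : ℝ)))
                + 1 / ((j : ℝ) ^ l * ((i : ℝ) - (j : ℝ)) * ((k : ℝ) - (j : ℝ)))
                + 1 / ((k : ℝ) ^ l * ((j : ℝ) - (k : ℝ)) * ((i : ℝ) - (k : ℝ))))
        + (-1 : ℝ) ^ (m - 1) * sumTriples r (fun a b c =>
            shiftConst k a / ((a : ℝ) ^ m * ((b : ℝ) - (a : ℝ)) * ((c : ℝ) - (a : ℝ)))
              + shiftConst k b / ((b : ℝ) ^ m * ((a : ℝ) - (b : ℝ)) * ((c : ℝ) - (b : ℝ)))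
              + shiftConst k c / ((c : ℝ) ^ m * ((b : ℝ) - (c : ℝ)) * ((a : ℝ) - (c : ℝ)))) := by
  simp only [shiftZeta, map_add, map_sum, map_smul, smul_eq_mul, tripleSum_apply, div_div,
    mul_assoc]

theorem shiftConst_zero (i : ℕ) : shiftConst 0 i = H 1 i := completeHarmonic_one i

theorem shiftConst_one (i : ℕ) :
    shiftConst 1 i = (H 1 i ^ 2 + H 2 i) / 2 + zetaValue 2 - H 1 i / (i : ℝ) := by
  rw [shiftConst, completeHarmonic_two, completeHarmonic_one, List.replicate_zero,
    multiZeta_singleton 2 le_rfl]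

theorem shiftConst_two (i : ℕ) :
    shiftConst 2 i = (H 1 i ^ 3 + 3 * H 1 i * H 2 i + 2 * H 3 i) / 6 + zetaValue 3
      - (H 1 i ^ 2 + H 2 i) / 2 / (i : ℝ) := by
  rw [shiftConst, completeHarmonic_three, completeHarmonic_two, List.replicate_one,
    multiZeta_two_one]

theorem W_two_zero (m : ℕ) (hm : 2 ≤ m) : W 2 0 m = elemZeta 1 m := by
  simpa using W_zero_eq 1 m hm

theorem W_three_zero (m : ℕ) (hm : 2 ≤ m) : W 3 0 m = 2 * elemZeta 2 m := by
  simpa [Nat.factorial] using W_zero_eq 2 m hm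

theorem W_four_zero (m : ℕ) (hm : 2 ≤ m) : W 4 0 m = 6 * elemZeta 3 m := by
  simpa [Nat.factorial] using W_zero_eq 3 m hm

theorem two_le_of_mem_Icc {l m : ℕ} (hl : l ∈ Icc 1 (m - 1)) : 2 ≤ m + 1 - l := by
  have := mem_Icc.1 hl
  omega

theorem W_two_formula (r m : ℕ) (hm : 2 ≤ m) :
    W 2 r m = W 2 0 m
      + ∑ l ∈ Icc 1 (m - 1), (-1 : ℝ) ^ (l - 1) * zetaValue (m + 1 - l) * H l r
      + (-1 : ℝ) ^ (m - 1) * ∑ j ∈ Icc 1 r, H 1 j / (j : ℝ) ^ m := by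
  rw [W_two_eq r m hm, W_two_zero m hm, singleSum_shiftZeta, add_assoc]
  simp only [shiftConst_zero]
  congr 2
  exact sum_congr rfl fun l hl => by rw [elemZeta_zero _ (two_le_of_mem_Icc hl)]

theorem W_three_formula (r m : ℕ) (hm : 2 ≤ m) :
    W 3 r m = W 3 0 m
        + 2 * ∑ i ∈ Finset.Icc 1 (m - 1), (-1 : ℝ) ^ (i - 1) * H i r * W 2 0 (m + 1 - i)
        + 2 * ∑ l ∈ Finset.Icc 1 (m - 1), (-1 : ℝ) ^ (l - 1) * zetaValue (m + 1 - l) *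
            sumPairs r (fun i j => 1 / ((i : ℝ) ^ l * ((j : ℝ) - (i : ℝ))))
        - 2 * ∑ l ∈ Finset.Icc 1 (m - 1), (-1 : ℝ) ^ (l - 1) * zetaValue (m + 1 - l) *
            sumPairs r (fun i j => 1 / ((j : ℝ) ^ l * ((j : ℝ) - (i : ℝ))))
        + (-1 : ℝ) ^ (m - 1) *
          ((∑ j ∈ Finset.Icc 1 r, (H 1 j ^ 2 + H 2 j) / (j : ℝ) ^ m)
            + 2 * zetaValue 2 * H m r
            - 2 * (∑ j ∈ Finset.Icc 1 r, H 1 j / (j : ℝ) ^ (m + 1))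
            + 2 * sumPairs r (fun i j => H 1 i / ((i : ℝ) ^ m * ((j : ℝ) - (i : ℝ))))
            - 2 * sumPairs r (fun i j => H 1 j / ((j : ℝ) ^ m * ((j : ℝ) - (i : ℝ))))) := by
  have e1 : ∑ i ∈ Icc 1 (m - 1), (-1 : ℝ) ^ (i - 1) * H i r * W 2 0 (m + 1 - i)
      = ∑ l ∈ Icc 1 (m - 1), ((-1) ^ (l - 1) * elemZeta 1 (m + 1 - l)) * H l r :=
    sum_congr rfl fun l hl => by rw [W_two_zero _ (two_le_of_mem_Icc hl)]; ring
  have e2 : ∀ (g : ℕ → ℝ) (l : ℕ), sumPairs r (fun i j => g i / ((i : ℝ) ^ l * ((j : ℝ) - (i : ℝ))))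
      - sumPairs r (fun i j => g j / ((j : ℝ) ^ l * ((j : ℝ) - (i : ℝ))))
      = sumPairs r (fun i j => 1 / ((j : ℝ) - (i : ℝ)) *
        (g i / (i : ℝ) ^ l - g j / (j : ℝ) ^ l)) := by
    intro g l
    simp only [sumPairs, ← sum_sub_distrib]
    refine sum_congr rfl fun _ _ => sum_congr rfl fun _ _ => ?_
    simp only [div_eq_mul_inv, mul_inv]
    ring
  have e3 : ∑ l ∈ Icc 1 (m - 1), ((-1) ^ (l - 1) * elemZeta 0 (m + 1 - l)) *
          sumPairs r (fun i j => 1 / ((j : ℝ) - (i : ℝ)) * (1 / (i : ℝ) ^ l - 1 / (j : ℝ) ^ l))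
      = ∑ l ∈ Finset.Icc 1 (m - 1), (-1 : ℝ) ^ (l - 1) * zetaValue (m + 1 - l) *
            sumPairs r (fun i j => 1 / ((i : ℝ) ^ l * ((j : ℝ) - (i : ℝ))))
        - ∑ l ∈ Finset.Icc 1 (m - 1), (-1 : ℝ) ^ (l - 1) * zetaValue (m + 1 - l) *
            sumPairs r (fun i j => 1 / ((j : ℝ) ^ l * ((j : ℝ) - (i : ℝ)))) := by
    rw [← sum_sub_distrib]
    refine sum_congr rfl fun l hl => ?_
    rw [← mul_sub, e2 (fun _ => 1), elemZeta_zero _ (two_le_of_mem_Icc hl)]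
  have e4 : 2 * ∑ i ∈ Icc 1 r, shiftConst 1 i / (i : ℝ) ^ m
      = (∑ j ∈ Finset.Icc 1 r, (H 1 j ^ 2 + H 2 j) / (j : ℝ) ^ m)
            + 2 * zetaValue 2 * H m r
            - 2 * (∑ j ∈ Finset.Icc 1 r, H 1 j / (j : ℝ) ^ (m + 1)) := by
    rw [H]
    simp only [mul_sum, ← sum_add_distrib, ← sum_sub_distrib]
    refine sum_congr rfl fun j _ => ?_
    rw [shiftConst_one, pow_succ]
    simp only [div_eq_mul_inv]
    ring
  rw [W_three_eq r m hm, W_three_zero m hm, singleSum_shiftZeta, pairSum_shiftZeta, e1, e3]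
  simp only [shiftConst_zero]
  rw [← e2 (H 1)]
  linear_combination (-1 : ℝ) ^ (m - 1) * e4

theorem W_four_formula (r m : ℕ) (hm : 2 ≤ m) :
    W 4 r m = W 4 0 m
        + 3 * ∑ l ∈ Finset.Icc 1 (m - 1), (-1 : ℝ) ^ (l - 1) * H l r * W 3 0 (m + 1 - l)
        + 6 * ∑ l ∈ Finset.Icc 1 (m - 1), (-1 : ℝ) ^ (l - 1) * W 2 0 (m + 1 - l) *
            sumPairs r (fun i j =>
              1 / ((j : ℝ) - (i : ℝ)) * (1 / (i : ℝ) ^ l - 1 / (j : ℝ) ^ l))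
        + (-1 : ℝ) ^ (m - 1) *
          (6 * zetaValue 3 * H m r
            - 3 * (∑ j ∈ Finset.Icc 1 r, (H 1 j ^ 2 + H 2 j) / (j : ℝ) ^ (m + 1))
            + ∑ j ∈ Finset.Icc 1 r,
                (H 1 j ^ 3 + 3 * H 1 j * H 2 j + 2 * H 3 j) / (j : ℝ) ^ m)
        + 6 * (-1 : ℝ) ^ (m - 1) * sumPairs r (fun i j =>
            1 / ((j : ℝ) - (i : ℝ)) *
              (1 / (i : ℝ) ^ m * ((H 1 i ^ 2 + H 2 i) / 2 + zetaValue 2 - H 1 i / (i : ℝ))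
                - 1 / (j : ℝ) ^ m *
                  ((H 1 j ^ 2 + H 2 j) / 2 + zetaValue 2 - H 1 j / (j : ℝ))))
        + 6 * ∑ l ∈ Finset.Icc 1 (m - 1), (-1 : ℝ) ^ (l - 1) * zetaValue (m + 1 - l) *
            sumTriples r (fun i j k =>
              1 / ((i : ℝ) ^ l * ((j : ℝ) - (i : ℝ)) * ((k : ℝ) - (i : ℝ)))
                + 1 / ((j : ℝ) ^ l * ((i : ℝ) - (j : ℝ)) * ((k : ℝ) - (j : ℝ)))
                + 1 / ((k : ℝ) ^ l * ((j : ℝ) - (k : ℝ)) * ((i : ℝ) - (k : ℝ))))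
        + 6 * (-1 : ℝ) ^ (m - 1) * sumTriples r (fun i j k =>
            H 1 i / ((i : ℝ) ^ m * ((j : ℝ) - (i : ℝ)) * ((k : ℝ) - (i : ℝ)))
              + H 1 j / ((j : ℝ) ^ m * ((i : ℝ) - (j : ℝ)) * ((k : ℝ) - (j : ℝ)))
              + H 1 k / ((k : ℝ) ^ m * ((j : ℝ) - (k : ℝ)) * ((i : ℝ) - (k : ℝ)))) := by
  -- W_{3,0} carries its own factor 2!, which turns the overall 3! into the coefficient 3.
  have e1 : 3 * ∑ l ∈ Icc 1 (m - 1), (-1 : ℝ) ^ (l - 1) * H l r * W 3 0 (m + 1 - l)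
      = 6 * ∑ l ∈ Icc 1 (m - 1), ((-1) ^ (l - 1) * elemZeta 2 (m + 1 - l)) * H l r := by
    simp only [mul_sum]
    exact sum_congr rfl fun l hl => by rw [W_three_zero _ (two_le_of_mem_Icc hl)]; ring
  have e2 : ∀ F : ℕ → ℝ, ∑ l ∈ Icc 1 (m - 1), (-1 : ℝ) ^ (l - 1) * W 2 0 (m + 1 - l) * F l
      = ∑ l ∈ Icc 1 (m - 1), (-1 : ℝ) ^ (l - 1) * elemZeta 1 (m + 1 - l) * F l :=
    fun F => sum_congr rfl fun l hl => by rw [W_two_zero _ (two_le_of_mem_Icc hl)]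
  have e3 : ∀ F : ℕ → ℝ, ∑ l ∈ Icc 1 (m - 1), (-1 : ℝ) ^ (l - 1) * zetaValue (m + 1 - l) * F l
      = ∑ l ∈ Icc 1 (m - 1), (-1 : ℝ) ^ (l - 1) * elemZeta 0 (m + 1 - l) * F l :=
    fun F => sum_congr rfl fun l hl => by rw [elemZeta_zero _ (two_le_of_mem_Icc hl)]
  have e4 : 6 * ∑ i ∈ Icc 1 r, shiftConst 2 i / (i : ℝ) ^ m
      = 6 * zetaValue 3 * H m r
            - 3 * (∑ j ∈ Finset.Icc 1 r, (H 1 j ^ 2 + H 2 j) / (j : ℝ) ^ (m + 1))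
            + ∑ j ∈ Finset.Icc 1 r,
                (H 1 j ^ 3 + 3 * H 1 j * H 2 j + 2 * H 3 j) / (j : ℝ) ^ m := by
    rw [H]
    simp only [mul_sum, ← sum_add_distrib, ← sum_sub_distrib]
    refine sum_congr rfl fun j _ => ?_
    rw [shiftConst_two, pow_succ]
    simp only [div_eq_mul_inv]
    ring
  rw [W_four_eq r m hm, W_four_zero m hm, singleSum_shiftZeta, pairSum_shiftZeta,
    tripleSum_shiftZeta, e1, e2, e3]
  simp only [shiftConst_one, shiftConst_zero, one_div_mul_eq_div]
  linear_combination (-1 : ℝ) ^ (m - 1) * e4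

/-! ### Membership of W_{2,r}, W_{3,r} and W_{4,r} in the zeta algebra. -/

theorem H_mem_zetaAlgebra (k n : ℕ) : H k n ∈ zetaAlgebra := by
  refine sum_mem fun j _ => ?_
  have := ratCast_mem_zetaAlgebra (1 / (j : ℚ) ^ k)
  push_cast at this
  exact this

theorem div_ratCast_mem_zetaAlgebra {x : ℝ} (hx : x ∈ zetaAlgebra) (q : ℚ) :
    x / (q : ℝ) ∈ zetaAlgebra := by
  rw [div_eq_mul_inv, ← Rat.cast_inv]
  exact mul_mem hx (ratCast_mem_zetaAlgebra _)

theorem completeHarmonic_mem_zetaAlgebra (k n : ℕ) : completeHarmonic k n ∈ zetaAlgebra := by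
  induction k generalizing n with
  | zero => simp [completeHarmonic]
  | succ k ih =>
    induction n with
    | zero => simp [completeHarmonic]
    | succ n ih2 =>
      rw [completeHarmonic]
      refine add_mem ih2 ?_
      simpa using div_ratCast_mem_zetaAlgebra (ih (n + 1)) ((n : ℚ) + 1)

theorem shiftConst_mem_zetaAlgebra (k i : ℕ) : shiftConst k i ∈ zetaAlgebra := by
  cases k with
  | zero => exact completeHarmonic_mem_zetaAlgebra _ _
  | succ k =>
    refine sub_mem (add_mem (completeHarmonic_mem_zetaAlgebra _ _)
      (multiZeta_mem_zetaAlgebra _ _ le_rfl)) ?_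
    simpa using div_ratCast_mem_zetaAlgebra (completeHarmonic_mem_zetaAlgebra (k + 1) i) (i : ℚ)

/-- The recursion in m only subtracts and divides by the integer i, so the explicit formulas are not
needed for membership. -/
theorem shiftZeta_mem_zetaAlgebra (k m i : ℕ) : shiftZeta k (m + 1) i ∈ zetaAlgebra := by
  induction m with
  | zero =>
    have e : shiftZeta k (0 + 1) i = shiftConst k i / (i : ℝ) := by simp [shiftZeta]
    rw [e]
    simpa using div_ratCast_mem_zetaAlgebra (shiftConst_mem_zetaAlgebra k i) (i : ℚ)
  | succ m ih =>
    rw [shiftZeta_succ]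
    simpa using div_ratCast_mem_zetaAlgebra
      (sub_mem (elemZeta_mem_zetaAlgebra k (m + 2) (by omega)) ih) (i : ℚ)

theorem singleSum_mem_zetaAlgebra (r : ℕ) {g : ℕ → ℝ} (hg : ∀ i, g i ∈ zetaAlgebra) :
    singleSum r g ∈ zetaAlgebra := by
  rw [singleSum_apply]
  exact sum_mem fun i _ => hg i

theorem pairSum_mem_zetaAlgebra (r : ℕ) {g : ℕ → ℝ} (hg : ∀ i, g i ∈ zetaAlgebra) :
    pairSum r g ∈ zetaAlgebra := by
  rw [pairSum_apply, sumPairs]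
  refine sum_mem fun j _ => sum_mem fun i _ => ?_
  rw [one_div_mul_eq_div]
  simpa using div_ratCast_mem_zetaAlgebra (sub_mem (hg i) (hg j)) ((j : ℚ) - i)

theorem tripleSum_mem_zetaAlgebra (r : ℕ) {g : ℕ → ℝ} (hg : ∀ i, g i ∈ zetaAlgebra) :
    tripleSum r g ∈ zetaAlgebra := by
  rw [tripleSum_apply, sumTriples]
  refine sum_mem fun k _ => sum_mem fun j _ => sum_mem fun i _ => add_mem (add_mem ?_ ?_) ?_
  · simpa using div_ratCast_mem_zetaAlgebra (hg i) (((j : ℚ) - i) * ((k : ℚ) - i))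
  · simpa using div_ratCast_mem_zetaAlgebra (hg j) (((i : ℚ) - j) * ((k : ℚ) - j))
  · simpa using div_ratCast_mem_zetaAlgebra (hg k) (((j : ℚ) - k) * ((i : ℚ) - k))

theorem W_zero_mem_zetaAlgebra (k m : ℕ) (hk : 1 ≤ k) (hm : 2 ≤ m) : W k 0 m ∈ zetaAlgebra := by
  obtain ⟨k, rfl⟩ := Nat.exists_eq_add_of_le' hk
  rw [W_zero_eq k m hm]
  exact mul_mem (natCast_mem _ _) (elemZeta_mem_zetaAlgebra k m hm)

theorem W_two_mem_zetaAlgebra (r m : ℕ) (hm : 2 ≤ m) : W 2 r m ∈ zetaAlgebra := by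
  rw [W_two_eq r m hm]
  obtain ⟨m, rfl⟩ := Nat.exists_eq_add_of_le' hm
  exact add_mem (elemZeta_mem_zetaAlgebra _ _ hm)
    (singleSum_mem_zetaAlgebra r (shiftZeta_mem_zetaAlgebra 0 (m + 1)))

theorem W_three_mem_zetaAlgebra (r m : ℕ) (hm : 2 ≤ m) : W 3 r m ∈ zetaAlgebra := by
  rw [W_three_eq r m hm]
  obtain ⟨m, rfl⟩ := Nat.exists_eq_add_of_le' hm
  exact mul_mem (ofNat_mem _ _) (add_mem (add_mem (elemZeta_mem_zetaAlgebra _ _ hm)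
    (singleSum_mem_zetaAlgebra r (shiftZeta_mem_zetaAlgebra 1 (m + 1))))
    (pairSum_mem_zetaAlgebra r (shiftZeta_mem_zetaAlgebra 0 (m + 1))))

theorem W_four_mem_zetaAlgebra (r m : ℕ) (hm : 2 ≤ m) : W 4 r m ∈ zetaAlgebra := by
  rw [W_four_eq r m hm]
  obtain ⟨m, rfl⟩ := Nat.exists_eq_add_of_le' hm
  exact mul_mem (ofNat_mem _ _) (add_mem (add_mem (add_mem (elemZeta_mem_zetaAlgebra _ _ hm)
    (singleSum_mem_zetaAlgebra r (shiftZeta_mem_zetaAlgebra 2 (m + 1))))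
    (pairSum_mem_zetaAlgebra r (shiftZeta_mem_zetaAlgebra 1 (m + 1))))
    (tripleSum_mem_zetaAlgebra r (shiftZeta_mem_zetaAlgebra 0 (m + 1))))

/-! ### Hyperharmonic numbers as binomials times shifted symmetric polynomials. -/

/-- The elementary symmetric polynomial `e_k(1/(a+1), …, 1/(a+n))`. -/
noncomputable def shiftedElem (a : ℕ) : ℕ → ℕ → ℝ
  | 0, _ => 1
  | _ + 1, 0 => 0
  | k + 1, n + 1 => shiftedElem a (k + 1) n + shiftedElem a k n / ((a : ℝ) + n + 1)

theorem shiftedElem_zero_left (k n : ℕ) : shiftedElem 0 k n = elemHarmonic k n := by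
  induction n generalizing k with
  | zero => cases k <;> simp [shiftedElem]
  | succ n ih =>
    cases k with
    | zero => simp [shiftedElem]
    | succ k => rw [shiftedElem, ih, ih, elemHarmonic_succ_succ, Nat.cast_zero, zero_add]

/-- The definition peels off the last variable 1/(a+n+1); this peels off the first, 1/(a+1). -/
theorem shiftedElem_succ_succ' (a k n : ℕ) :
    shiftedElem a (k + 1) (n + 1)
      = shiftedElem (a + 1) (k + 1) n + shiftedElem (a + 1) k n / ((a : ℝ) + 1) := by
  induction n generalizing k with
  | zero => cases k <;> simp [shiftedElem]
  | succ n ih =>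
    rw [shiftedElem, ih, shiftedElem.eq_3 (a + 1) k n]
    cases k with
    | zero =>
      simp only [shiftedElem]
      push_cast
      ring
    | succ k =>
      rw [ih, shiftedElem.eq_3 (a + 1) k n]
      push_cast
      ring

/-- The increment in n of the claimed closed form at level m+1 must be the closed form at level m.
Peeling the last variable on one side and the first on the other leaves two comparisons: Pascal's
rule `h1`, and the equality `h5` of the weights on the two peeled terms. -/
theorem hyperharmonic_succ_eq (m k n : ℕ) :
    hyperharmonic (m + 1) (k + 1) n = ((n + m).choose n : ℝ) * shiftedElem m (k + 1) n := by
  induction m generalizing n with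
  | zero => simp [hyperharmonic, shiftedElem_zero_left, elemHarmonic]
  | succ m ih =>
    rw [hyperharmonic]
    induction n with
    | zero => simp [shiftedElem]
    | succ n ih2 =>
      rw [Finset.sum_Icc_succ_top (by omega), ih2, ih, shiftedElem_succ_succ', shiftedElem]
      have h1 : ((n + 1 + (m + 1)).choose (n + 1) : ℝ)
          = (n + (m + 1)).choose n + (n + 1 + m).choose (n + 1) := by
        rw [show n + 1 + (m + 1) = n + (m + 1) + 1 by ring, Nat.choose_succ_succ,
          show n + (m + 1) = n + 1 + m by ring]
        push_cast
        ring
      have h2 : ((n + 1 + (m + 1)).choose (n + 1) : ℝ) * (m + 1)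
          = (n + 1 + m).choose (n + 1) * (n + m + 2) := by
        have := Nat.choose_mul_succ_eq (n + 1 + m) (n + 1)
        rw [show n + 1 + m + 1 - (n + 1) = m + 1 by omega] at this
        rw [show n + 1 + (m + 1) = n + 1 + m + 1 by ring]
        have h := congrArg (Nat.cast (R := ℝ)) this
        push_cast at h
        linear_combination -h
      have h3 : (m : ℝ) + 1 ≠ 0 := by positivity
      have h4 : ((m + 1 : ℕ) : ℝ) + n + 1 ≠ 0 := by positivity
      have h5 : ((n + 1 + (m + 1)).choose (n + 1) : ℝ) / (((m + 1 : ℕ) : ℝ) + n + 1)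
          = (n + 1 + m).choose (n + 1) / ((m : ℝ) + 1) := by
        rw [div_eq_div_iff h4 h3, h2]
        push_cast
        ring
      linear_combination (-shiftedElem (m + 1) (k + 1) n) * h1 - shiftedElem (m + 1) k n * h5

theorem elemHarmonic_one (n : ℕ) : elemHarmonic 1 n = H 1 n := by
  induction n with
  | zero => simp
  | succ n ih => rw [elemHarmonic_succ_succ, ih, H_succ, elemHarmonic_zero, pow_one]

theorem elemHarmonic_two (n : ℕ) : elemHarmonic 2 n = (H 1 n ^ 2 - H 2 n) / 2 := by
  induction n with
  | zero => simp
  | succ n ih =>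
    rw [elemHarmonic_succ_succ, ih, elemHarmonic_one, H_succ, H_succ]
    have : (n : ℝ) + 1 ≠ 0 := by positivity
    field_simp
    ring

theorem elemHarmonic_three (n : ℕ) :
    elemHarmonic 3 n = (H 1 n ^ 3 - 3 * H 1 n * H 2 n + 2 * H 3 n) / 6 := by
  induction n with
  | zero => simp
  | succ n ih =>
    rw [elemHarmonic_succ_succ, ih, elemHarmonic_two, H_succ, H_succ, H_succ]
    have : (n : ℝ) + 1 ≠ 0 := by positivity
    field_simp
    ring

/-- The generating product of the block a+1, …, a+n is that of 1, …, n+a divided by that of 1, …, a,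
and the reciprocal of the latter generates (-1)^s h_s(a). Here and in the next two lemmas h_s(a) is
written in power sums. -/
theorem shiftedElem_one (a n : ℕ) :
    shiftedElem a 1 n = elemHarmonic 1 (n + a) - H 1 a := by
  induction n with
  | zero => simp [shiftedElem, elemHarmonic_one]
  | succ n ih =>
    rw [shiftedElem, ih, show n + 1 + a = n + a + 1 by ring, elemHarmonic_succ_succ,
      elemHarmonic_zero, shiftedElem]
    push_cast
    ring

theorem shiftedElem_two (a n : ℕ) :
    shiftedElem a 2 n = elemHarmonic 2 (n + a) - H 1 a * elemHarmonic 1 (n + a)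
      + (H 1 a ^ 2 + H 2 a) / 2 := by
  induction n with
  | zero =>
    rw [zero_add, elemHarmonic_two, elemHarmonic_one, shiftedElem]
    ring
  | succ n ih =>
    rw [shiftedElem, ih, show n + 1 + a = n + a + 1 by ring, elemHarmonic_succ_succ 1,
      elemHarmonic_succ_succ 0, elemHarmonic_zero, shiftedElem_one]
    push_cast
    ring

theorem shiftedElem_three (a n : ℕ) :
    shiftedElem a 3 n = elemHarmonic 3 (n + a) - H 1 a * elemHarmonic 2 (n + a)
      + (H 1 a ^ 2 + H 2 a) / 2 * elemHarmonic 1 (n + a)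
      - (H 1 a ^ 3 + 3 * H 1 a * H 2 a + 2 * H 3 a) / 6 := by
  induction n with
  | zero =>
    rw [zero_add, elemHarmonic_three, elemHarmonic_two, elemHarmonic_one, shiftedElem]
    ring
  | succ n ih =>
    rw [shiftedElem, ih, show n + 1 + a = n + a + 1 by ring, elemHarmonic_succ_succ 2,
      elemHarmonic_succ_succ 1, elemHarmonic_succ_succ 0, elemHarmonic_zero, shiftedElem_two]
    push_cast
    ring

theorem elemHarmonic_eq_zero_of_lt {k n : ℕ} (h : n < k) : elemHarmonic k n = 0 := by
  rw [← stirlingFirst_div_factorial, Nat.stirlingFirst_eq_zero_of_lt (by omega)]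
  simp

/-- The binomial is ∏_{j ≤ a} (1 + n/j), the generating product at y = n. -/
theorem choose_eq_sum_elemHarmonic (a n : ℕ) :
    ((n + a).choose n : ℝ) = ∑ j ∈ range (a + 1), elemHarmonic j a * (n : ℝ) ^ j := by
  have h1 := hasSum_elemHarmonic_mul_pow (n : ℝ) a
  simp only [RCLike.ofReal_real_eq_id, id] at h1
  have h2 : HasSum (fun j => elemHarmonic j a * (n : ℝ) ^ j)
      (∑ j ∈ range (a + 1), elemHarmonic j a * (n : ℝ) ^ j) :=
    hasSum_sum_of_ne_finset_zero fun j hj => by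
      rw [elemHarmonic_eq_zero_of_lt (by simpa using hj), zero_mul]
  rw [h2.unique h1]
  clear h1 h2
  induction a with
  | zero => simp
  | succ a ih =>
    rw [prod_range_succ, ← ih]
    have h3 : (a : ℝ) + 1 ≠ 0 := by positivity
    have h := Nat.choose_mul_succ_eq (n + a) n
    rw [show n + a + 1 - n = a + 1 by omega] at h
    have h := congrArg (Nat.cast (R := ℝ)) h
    push_cast at h
    rw [← add_assoc]
    field_simp
    linear_combination -h

/-! ### Evaluation of S(2, r; p) and S(3, r; p). -/

theorem hasSum_STerm (k a p : ℕ) (hp : a + 2 ≤ p) {s : ℕ → ℝ}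
    (hs : ∀ m, 2 ≤ m →
      HasSum (fun n : ℕ => shiftedElem a (k + 1) (n + 1) / ((n : ℝ) + 1) ^ m) (s m)) :
    HasSum (fun n : ℕ => STerm (k + 1) (a + 1) p (n + 1))
      (1 / (a.factorial : ℝ) *
        ∑ j ∈ Icc 1 (a + 1), (Nat.stirlingFirst (a + 1) j : ℝ) * s (p + 1 - j)) := by
  -- The binomial has degree a in n, so the exponent p drops to p - j with j ≤ a; the hypothesis p ≥
  -- a + 2 keeps it at least 2. The coefficients e_j(a) are the Stirling numbers [a+1, j+1] / a!.
  have h := hasSum_sum (s := range (a + 1))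
    (f := fun j n => elemHarmonic j a * (shiftedElem a (k + 1) (n + 1) / ((n : ℝ) + 1) ^ (p - j)))
    (a := fun j => elemHarmonic j a * s (p - j))
    fun j hj => (hs _ (by have := mem_range.1 hj; omega)).mul_left _
  have e : ∑ j ∈ range (a + 1), elemHarmonic j a * s (p - j) = 1 / (a.factorial : ℝ) *
        ∑ j ∈ Icc 1 (a + 1), (Nat.stirlingFirst (a + 1) j : ℝ) * s (p + 1 - j) := by
    rw [sum_Icc_one_eq_sum_range, mul_sum]
    refine sum_congr rfl fun j _ => ?_
    rw [← stirlingFirst_div_factorial, Nat.add_sub_add_right]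
    ring
  rw [← e]
  refine h.congr_fun fun n => ?_
  rw [STerm, hyperharmonic_succ_eq, choose_eq_sum_elemHarmonic, sum_mul, sum_div]
  refine sum_congr rfl fun j hj => ?_
  have hj' : j ≤ p := by have := mem_range.1 hj; omega
  have hn : (n : ℝ) + 1 ≠ 0 := by positivity
  push_cast
  rw [← Nat.sub_add_cancel hj', Nat.add_sub_cancel, pow_add]
  field_simp

theorem hasSum_W (k r m : ℕ) (hm : 2 ≤ m) :
    HasSum (fun n : ℕ => elemHarmonic k (n + 1 + r) / ((n : ℝ) + 1) ^ m)
      (W (k + 1) r m / k.factorial) := by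
  have h := (summable_elemHarmonic_shift k (1 + r) m hm).hasSum
  simp only [← add_assoc] at h
  have hk : (k.factorial : ℝ) ≠ 0 := by positivity
  rwa [W_eq_of_hasSum h, mul_div_cancel_left₀ _ hk]

theorem hasSum_STerm_two (a p : ℕ) (hp : a + 2 ≤ p) :
    HasSum (fun n : ℕ => STerm 2 (a + 1) p (n + 1))
      (1 / ((Nat.factorial 2 : ℝ) * (a.factorial : ℝ)) *
        ∑ k ∈ Icc 1 (a + 1), (Nat.stirlingFirst (a + 1) k : ℝ) *
          (W 3 a (p + 1 - k) - 2 * H 1 a * W 2 a (p + 1 - k)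
            + (H 1 a ^ 2 + H 2 a) * zetaValue (p + 1 - k))) := by
  have h := hasSum_STerm 1 a p hp
    (s := fun m => 1 / 2 * (W 3 a m - 2 * H 1 a * W 2 a m + (H 1 a ^ 2 + H 2 a) * zetaValue m))
    fun m hm => by
      have h := ((hasSum_W 2 a m hm).sub ((hasSum_W 1 a m hm).mul_left (H 1 a))).add
        ((hasSum_zetaValue m hm).mul_left ((H 1 a ^ 2 + H 2 a) / 2))
      convert! h.congr_fun fun n => ?_ using 1
      · simp [Nat.factorial]
        ring
      · rw [shiftedElem_two]
        ring
  convert h using 1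
  simp only [Nat.factorial, mul_sum]
  refine sum_congr rfl fun j _ => ?_
  push_cast
  field_simp

theorem hasSum_STerm_three (a p : ℕ) (hp : a + 2 ≤ p) :
    HasSum (fun n : ℕ => STerm 3 (a + 1) p (n + 1))
      (1 / ((Nat.factorial 3 : ℝ) * (a.factorial : ℝ)) *
        ∑ k ∈ Icc 1 (a + 1), (Nat.stirlingFirst (a + 1) k : ℝ) *
          (W 4 a (p + 1 - k) - 3 * H 1 a * W 3 a (p + 1 - k)
            + 3 * (H 1 a ^ 2 + H 2 a) * W 2 a (p + 1 - k)
            - (H 1 a ^ 3 + 3 * H 1 a * H 2 a + 2 * H 3 a) * zetaValue (p + 1 - k))) := by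
  have h := hasSum_STerm 2 a p hp
    (s := fun m => 1 / 6 * (W 4 a m - 3 * H 1 a * W 3 a m + 3 * (H 1 a ^ 2 + H 2 a) * W 2 a m
      - (H 1 a ^ 3 + 3 * H 1 a * H 2 a + 2 * H 3 a) * zetaValue m))
    fun m hm => by
      have h := (((hasSum_W 3 a m hm).sub ((hasSum_W 2 a m hm).mul_left (H 1 a))).add
        ((hasSum_W 1 a m hm).mul_left ((H 1 a ^ 2 + H 2 a) / 2))).sub
        ((hasSum_zetaValue m hm).mul_left ((H 1 a ^ 3 + 3 * H 1 a * H 2 a + 2 * H 3 a) / 6))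
      convert! h.congr_fun fun n => ?_ using 1
      · simp [Nat.factorial]
        ring
      · rw [shiftedElem_three]
        ring
  convert h using 1
  simp only [Nat.factorial, mul_sum]
  refine sum_congr rfl fun j _ => ?_
  push_cast
  field_simp

theorem one_div_natCast_mem_zetaAlgebra (q : ℕ) : 1 / (q : ℝ) ∈ zetaAlgebra := by
  simpa using ratCast_mem_zetaAlgebra ((q : ℚ)⁻¹)

theorem S_two_mem_zetaAlgebra (a p : ℕ) (hp : a + 2 ≤ p) : S 2 (a + 1) p ∈ zetaAlgebra := by
  rw [S, (hasSum_STerm_two a p hp).tsum_eq, ← Nat.cast_mul]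
  have h1 := H_mem_zetaAlgebra 1 a
  have h2 := H_mem_zetaAlgebra 2 a
  refine mul_mem (one_div_natCast_mem_zetaAlgebra _) (sum_mem fun k hk => ?_)
  have hk' : 2 ≤ p + 1 - k := by have := mem_Icc.1 hk; omega
  exact mul_mem (natCast_mem _ _) (add_mem (sub_mem (W_three_mem_zetaAlgebra _ _ hk')
    (mul_mem (mul_mem (ofNat_mem _ _) h1) (W_two_mem_zetaAlgebra _ _ hk')))
    (mul_mem (add_mem (pow_mem h1 2) h2) (zetaValue_mem_zetaAlgebra hk')))

theorem S_three_mem_zetaAlgebra (a p : ℕ) (hp : a + 2 ≤ p) : S 3 (a + 1) p ∈ zetaAlgebra := by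
  rw [S, (hasSum_STerm_three a p hp).tsum_eq, ← Nat.cast_mul]
  have h1 := H_mem_zetaAlgebra 1 a
  have h2 := H_mem_zetaAlgebra 2 a
  have h3 := H_mem_zetaAlgebra 3 a
  refine mul_mem (one_div_natCast_mem_zetaAlgebra _) (sum_mem fun k hk => ?_)
  have hk' : 2 ≤ p + 1 - k := by have := mem_Icc.1 hk; omega
  exact mul_mem (natCast_mem _ _) (sub_mem (add_mem (sub_mem (W_four_mem_zetaAlgebra _ _ hk')
    (mul_mem (mul_mem (ofNat_mem _ _) h1) (W_three_mem_zetaAlgebra _ _ hk')))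
    (mul_mem (mul_mem (ofNat_mem _ _) (add_mem (pow_mem h1 2) h2))
      (W_two_mem_zetaAlgebra _ _ hk')))
    (mul_mem (add_mem (add_mem (pow_mem h1 3) (mul_mem (mul_mem (ofNat_mem _ _) h1) h2))
      (mul_mem (ofNat_mem _ _) h3)) (zetaValue_mem_zetaAlgebra hk')))

end EulerSums

open EulerSums in
theorem mainTheorem4 :
    -- all the series and limits that occur converge
    (∀ k r m : ℕ, 1 ≤ k → 2 ≤ m → Summable (fun n : ℕ => WTerm k r m (n + 1))) ∧
    (∀ m k : ℕ, 2 ≤ m →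
      Filter.Tendsto (fun n : ℕ => multiHarmonic (m :: List.replicate k 1) n) Filter.atTop
        (nhds (multiZeta (m :: List.replicate k 1)))) ∧
    -- W_{k,0} in terms of multiple zeta values
    (∀ k m : ℕ, 2 ≤ k → 2 ≤ m →
      W k 0 m = (Nat.factorial (k - 1) : ℝ) *
        (multiZeta ((m + 1) :: List.replicate (k - 2) 1)
          + multiZeta (m :: List.replicate (k - 1) 1))) ∧
    -- the Aomoto-Drinfeld-Zagier formula
    (∀ x y : ℂ, ‖x‖ < 1 → ‖y‖ < 1 → ‖x + y‖ < 1 →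
      Summable (fun n : ℕ => riemannZeta ((n : ℂ) + 2) *
        ((x ^ (n + 2) + y ^ (n + 2) - (x + y) ^ (n + 2)) / ((n : ℂ) + 2))) ∧
      HasSum (fun q : ℕ × ℕ =>
          (multiZeta ((q.1 + 2) :: List.replicate q.2 1) : ℂ) * x ^ (q.1 + 1) * y ^ (q.2 + 1))
        (1 - Complex.exp (∑' n : ℕ, riemannZeta ((n : ℂ) + 2) *
          ((x ^ (n + 2) + y ^ (n + 2) - (x + y) ^ (n + 2)) / ((n : ℂ) + 2))))) ∧
    -- reduction to polynomials in zeta values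
    (∀ m k : ℕ, 2 ≤ m → multiZeta (m :: List.replicate k 1) ∈ zetaAlgebra) ∧
    (∀ k m : ℕ, 1 ≤ k → 2 ≤ m → W k 0 m ∈ zetaAlgebra) ∧
    -- W_{2,r}
    (∀ r m : ℕ, 2 ≤ m →
      W 2 r m = W 2 0 m
        + ∑ l ∈ Finset.Icc 1 (m - 1), (-1 : ℝ) ^ (l - 1) * zetaValue (m + 1 - l) * H l r
        + (-1 : ℝ) ^ (m - 1) * ∑ j ∈ Finset.Icc 1 r, H 1 j / (j : ℝ) ^ m) ∧
    -- W_{3,r}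
    (∀ r m : ℕ, 2 ≤ m →
      W 3 r m = W 3 0 m
        + 2 * ∑ i ∈ Finset.Icc 1 (m - 1), (-1 : ℝ) ^ (i - 1) * H i r * W 2 0 (m + 1 - i)
        + 2 * ∑ l ∈ Finset.Icc 1 (m - 1), (-1 : ℝ) ^ (l - 1) * zetaValue (m + 1 - l) *
            sumPairs r (fun i j => 1 / ((i : ℝ) ^ l * ((j : ℝ) - (i : ℝ))))
        - 2 * ∑ l ∈ Finset.Icc 1 (m - 1), (-1 : ℝ) ^ (l - 1) * zetaValue (m + 1 - l) *
            sumPairs r (fun i j => 1 / ((j : ℝ) ^ l * ((j : ℝ) - (i : ℝ))))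
        + (-1 : ℝ) ^ (m - 1) *
          ((∑ j ∈ Finset.Icc 1 r, (H 1 j ^ 2 + H 2 j) / (j : ℝ) ^ m)
            + 2 * zetaValue 2 * H m r
            - 2 * (∑ j ∈ Finset.Icc 1 r, H 1 j / (j : ℝ) ^ (m + 1))
            + 2 * sumPairs r (fun i j => H 1 i / ((i : ℝ) ^ m * ((j : ℝ) - (i : ℝ))))
            - 2 * sumPairs r (fun i j => H 1 j / ((j : ℝ) ^ m * ((j : ℝ) - (i : ℝ)))))) ∧
    -- W_{4,r}
    (∀ r m : ℕ, 2 ≤ m →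
      W 4 r m = W 4 0 m
        + 3 * ∑ l ∈ Finset.Icc 1 (m - 1), (-1 : ℝ) ^ (l - 1) * H l r * W 3 0 (m + 1 - l)
        + 6 * ∑ l ∈ Finset.Icc 1 (m - 1), (-1 : ℝ) ^ (l - 1) * W 2 0 (m + 1 - l) *
            sumPairs r (fun i j =>
              1 / ((j : ℝ) - (i : ℝ)) * (1 / (i : ℝ) ^ l - 1 / (j : ℝ) ^ l))
        + (-1 : ℝ) ^ (m - 1) *
          (6 * zetaValue 3 * H m r
            - 3 * (∑ j ∈ Finset.Icc 1 r, (H 1 j ^ 2 + H 2 j) / (j : ℝ) ^ (m + 1))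
            + ∑ j ∈ Finset.Icc 1 r,
                (H 1 j ^ 3 + 3 * H 1 j * H 2 j + 2 * H 3 j) / (j : ℝ) ^ m)
        + 6 * (-1 : ℝ) ^ (m - 1) * sumPairs r (fun i j =>
            1 / ((j : ℝ) - (i : ℝ)) *
              (1 / (i : ℝ) ^ m * ((H 1 i ^ 2 + H 2 i) / 2 + zetaValue 2 - H 1 i / (i : ℝ))
                - 1 / (j : ℝ) ^ m *
                  ((H 1 j ^ 2 + H 2 j) / 2 + zetaValue 2 - H 1 j / (j : ℝ))))
        + 6 * ∑ l ∈ Finset.Icc 1 (m - 1), (-1 : ℝ) ^ (l - 1) * zetaValue (m + 1 - l) *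
            sumTriples r (fun i j k =>
              1 / ((i : ℝ) ^ l * ((j : ℝ) - (i : ℝ)) * ((k : ℝ) - (i : ℝ)))
                + 1 / ((j : ℝ) ^ l * ((i : ℝ) - (j : ℝ)) * ((k : ℝ) - (j : ℝ)))
                + 1 / ((k : ℝ) ^ l * ((j : ℝ) - (k : ℝ)) * ((i : ℝ) - (k : ℝ))))
        + 6 * (-1 : ℝ) ^ (m - 1) * sumTriples r (fun i j k =>
            H 1 i / ((i : ℝ) ^ m * ((j : ℝ) - (i : ℝ)) * ((k : ℝ) - (i : ℝ)))
              + H 1 j / ((j : ℝ) ^ m * ((i : ℝ) - (j : ℝ)) * ((k : ℝ) - (j : ℝ)))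
              + H 1 k / ((k : ℝ) ^ m * ((j : ℝ) - (k : ℝ)) * ((i : ℝ) - (k : ℝ))))) ∧
    -- S(2,r;p) and S(3,r;p)
    (∀ r p : ℕ, 1 ≤ r → r + 1 ≤ p →
      Summable (fun n : ℕ => STerm 2 r p (n + 1)) ∧
      S 2 r p = 1 / ((Nat.factorial 2 : ℝ) * (Nat.factorial (r - 1) : ℝ)) *
        ∑ k ∈ Finset.Icc 1 r, (Nat.stirlingFirst r k : ℝ) *
          (W 3 (r - 1) (p + 1 - k) - 2 * H 1 (r - 1) * W 2 (r - 1) (p + 1 - k)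
            + (H 1 (r - 1) ^ 2 + H 2 (r - 1)) * zetaValue (p + 1 - k)) ∧
      S 2 r p ∈ zetaAlgebra) ∧
    (∀ r p : ℕ, 1 ≤ r → r + 1 ≤ p →
      Summable (fun n : ℕ => STerm 3 r p (n + 1)) ∧
      S 3 r p = 1 / ((Nat.factorial 3 : ℝ) * (Nat.factorial (r - 1) : ℝ)) *
        ∑ k ∈ Finset.Icc 1 r, (Nat.stirlingFirst r k : ℝ) *
          (W 4 (r - 1) (p + 1 - k) - 3 * H 1 (r - 1) * W 3 (r - 1) (p + 1 - k)
            + 3 * (H 1 (r - 1) ^ 2 + H 2 (r - 1)) * W 2 (r - 1) (p + 1 - k)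
            - (H 1 (r - 1) ^ 3 + 3 * H 1 (r - 1) * H 2 (r - 1) + 2 * H 3 (r - 1)) *
                zetaValue (p + 1 - k)) ∧
      S 3 r p ∈ zetaAlgebra) := by
  refine ⟨summable_WTerm, fun m k hm => (hasSum_multiZeta k m hm).2, ?_, ?_,
    fun m k hm => multiZeta_mem_zetaAlgebra k m hm, W_zero_mem_zetaAlgebra, W_two_formula,
    W_three_formula, W_four_formula, ?_, ?_⟩
  · intro k m hk hm
    obtain ⟨k, rfl⟩ := Nat.exists_eq_add_of_le' hk
    rw [W_zero_eq (k + 1) m hm, elemZeta_succ k m hm]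
    rfl
  · exact fun x y hx hy hxy =>
      ⟨(hasSum_log hx hy hxy).summable, hasSum_multiZeta_generating hx hy hxy⟩
  · intro r p hr hp
    obtain ⟨a, rfl⟩ := Nat.exists_eq_add_of_le' hr
    have h := hasSum_STerm_two a p hp
    exact ⟨h.summable, h.tsum_eq, S_two_mem_zetaAlgebra a p hp⟩
  · intro r p hr hp
    obtain ⟨a, rfl⟩ := Nat.exists_eq_add_of_le' hr
    have h := hasSum_STerm_three a p hp
    exact ⟨h.summable, h.tsum_eq, S_three_mem_zetaAlgebra a p hp⟩
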